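/- **Model.** Let $S$ be a finite set of states of the world, which are also the possible actions, and $X$ a finite set of private signals. Let $G=(V,E)$ be an undirected graph of agents, finite or infinite; $\partial i$ denotes the set of neighbors of $i$. The state $s\in S$ is drawn from a prior $P(s)$; given $s$, the agents' private signals $x_i\in X$ are independent, $x_i$ having law $P_i(\cdot\mid s)$. At each time $t=0,1,2,\dots$ every agent $i$ takes an action $\sigma_i(t)\in\arg\max_{s\in S}P(s\mid\mathcal F_i^t)$, where $\mathcal F_i^t$ consists of $x_i$ and of the actions $\sigma_j(t')$ of her neighbors $j\in\partial i$ at all times $t'<t$ (these determine her own earlier actions). Ties are broken by a deterministic rule, which may depend on the agent, the time and her information. The graph, the prior, the signal distributions and the tie breaking rule are common knowledge. **Model of computation.** Computational effort is the number of elementary operations of a program of a first-order functional language on lists, vertex names and real numbers, in which each of the following costs one unit: evaluating a variable, a natural number constant or the empty list; forming a pair or taking one apart; addition, subtraction, multiplication and comparison of real numbers; comparison of two vertex names; a test for the empty list; binding a variable; a function call; access to the prior; access to the adjacency list or the signal probabilities of a given vertex; a query to the tie breaking rule. **Theorem.** There is a single program such that for every two finite sets $S$, $X$ there is a constant $C$,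 depending only on $|S|$ and $|X|$, with the following property. If $G$ is a tree in which all degrees are at most $d$, where $d\ge1$, then for every agent $i$, every time $t\ge0$ and every realization of the private signals, the program, given $i$, $t$, $x_i$ and the actions of the neighbors of $i$ at the times before $t$, computes $i$'s Bayesian actions $\sigma_i(0),\dots,\sigma_i(t)$ with computational effort at most $2^{C\max(1,td)}$, that is, $2^{O(td)}$. -/

import Mathlib

open MeasureTheory ProbabilityTheory

noncomputable section

namespace SocialLearning

/-! ## The learning model

States of the world, which are also the possible actions, are the elements of `Fin m`; private
signals take values in `Fin k`. -/

/-- The common knowledge of the agents: the social network (an undirected simple graph on `V`,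
possibly infinite, given together with an adjacency list of every agent), the prior distribution
of the state of the world, the conditional distribution of the private signal of every agent given
the state, and a deterministic tie breaking rule.

`tie i t a o A` is the action that agent `i` takes at time `t` when her private signal is `a`, the
past actions of her neighbors (in the order of `nbrs i`) are `o`, and the set of actions of maximal
posterior probability is `A`. -/
structure Model (V : Type*) (m k : ℕ) where
  graph : SimpleGraph V
  nbrs : V → List V
  nodup_nbrs : ∀ i, (nbrs i).Nodup
  mem_nbrs : ∀ i j, j ∈ nbrs i ↔ graph.Adj i j
  prior : PMF (Fin m)
  signal : V → Fin m → PMF (Fin k)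
  tie : V → ℕ → Fin k → List (List (Fin m)) → Finset (Fin m) → Fin m
  tie_mem : ∀ i t a o A, A.Nonempty → tie i t a o A ∈ A

namespace Model

variable {V : Type*} {m k : ℕ} (M : Model V m k)

/-- The joint law of the state of the world and of the private signals: the state is drawn from the
prior and, given the state, the signals are independent. -/
def law : Measure (Fin m × (V → Fin k)) :=
  ∑ s : Fin m, M.prior s •
    (Measure.dirac s).prod (Measure.infinitePi fun v => (M.signal v s).toMeasure)

/-- The posterior probability of the state `s`, given that the vector of private signals
belongs to `E`. -/
def posterior (E : Set (V → Fin k)) (s : Fin m) : ENNReal :=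
  (M.law[|Prod.snd ⁻¹' E]) (Prod.fst ⁻¹' {s})

/-- The states of maximal posterior probability. -/
def best (E : Set (V → Fin k)) : Finset (Fin m) := by
  classical exact Finset.univ.filter fun s => ∀ s', M.posterior E s' ≤ M.posterior E s

/-- `M.traj t i x` is the list of the actions of agent `i` at the times `t - 1, …, 1, 0` (the most
recent action first) when the vector of private signals is `x`.

At time `t` agent `i` knows her own signal and the actions of her neighbors at the times before
`t` (her own earlier actions are a function of these), and she takes an action of maximal
posterior probability given this information. -/
def traj : ℕ → V → (V → Fin k) → List (Fin m)
  | 0, _, _ => []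
  | t + 1, i, x =>
    M.tie i t (x i) ((M.nbrs i).map fun j => traj t j x)
        (M.best {y | y i = x i ∧ ∀ j, M.graph.Adj i j → traj t j y = traj t j x}) ::
      traj t i x

end Model

/-! ## The model of computation

A first-order functional language on lists, vertices and real numbers. Every elementary operation
has unit cost: arithmetic and comparisons are exact, as on a real RAM, and there is neither a
rounding operation nor a real constant that is not a natural number. -/

/-- The data: the empty list, real numbers, vertices (as names that can only be compared for
equality and used to look up the local data of the vertex), and pairs. Lists are nested pairs. -/
inductive Val (V : Type*) where
  | nil : Val V
  | num : ℝ → Val V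
  | vtx : V → Val V
  | cons : Val V → Val V → Val V

/-- Expressions; `var n` is the `n`-th entry of the current environment, and `call f e` calls
function number `f` of the program with argument `e`. -/
inductive Code where
  | var : ℕ → Code
  | lit : ℕ → Code
  | nil : Code
  | cons : Code → Code → Code
  | head : Code → Code
  | tail : Code → Code
  | add : Code → Code → Code
  | sub : Code → Code → Code
  | mul : Code → Code → Code
  | bind : Code → Code → Code
  | ifNil : Code → Code → Code → Code
  | ifLe : Code → Code → Code → Code → Code
  | ifEq : Code → Code → Code → Code → Code
  | nbrs : Code → Code
  | prior : Code
  | signal : Code → Code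
  | tie : Code → Code
  | call : ℕ → Code → Code

/-- A program is a finite list of functions of one argument; a function is given by its body. -/
abbrev Program := List Code

variable {V : Type*} {m k : ℕ}

/-- A list as a datum, given the encoding of its entries. -/
def Val.ofList {α : Type*} (f : α → Val V) : List α → Val V
  | [] => .nil
  | a :: l => .cons (f a) (Val.ofList f l)

/-- States, actions, signals and times as data. -/
def Val.ofFin {n : ℕ} (a : Fin n) : Val V := .num ((a : ℕ) : ℝ)

/-- A distribution on `Fin n` as the list of its probabilities. -/
def Val.ofPMF {n : ℕ} (p : PMF (Fin n)) : Val V :=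
  Val.ofList (fun a => .num (p a).toReal) (List.finRange n)

/-- A set of states as the increasing list of its elements. -/
def Val.ofFinset (A : Finset (Fin m)) : Val V :=
  Val.ofList Val.ofFin ((List.finRange m).filter fun s => s ∈ A)

/-- A name of an agent, a time, her signal, and the lists of the past actions of her neighbors,
followed by a datum `r`. -/
def Val.view (i : V) (t : ℕ) (a : Fin k) (o : List (List (Fin m))) (r : Val V) : Val V :=
  .cons (.vtx i) (.cons (.num t) (.cons (Val.ofFin a)
    (.cons (Val.ofList (Val.ofList Val.ofFin) o) r)))

/-- `Eval M P env e v c`: in the environment `env`, the expression `e` evaluates to `v` with `c`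
elementary operations. The program `P` has unit cost access to the common knowledge `M`: to the
adjacency list of a vertex, to the table of the signal distributions of a vertex (one list of
probabilities for each state), to the list of the prior probabilities, and to the
tie breaking rule. -/
inductive Eval (M : Model V m k) (P : Program) : List (Val V) → Code → Val V → ℕ → Prop where
  | var {env n v} : env[n]? = some v → Eval M P env (.var n) v 1
  | lit {env} (n : ℕ) : Eval M P env (.lit n) (.num n) 1
  | nil {env} : Eval M P env .nil .nil 1
  | cons {env e₁ e₂ v₁ v₂ c₁ c₂} : Eval M P env e₁ v₁ c₁ → Eval M P env e₂ v₂ c₂ →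
      Eval M P env (.cons e₁ e₂) (.cons v₁ v₂) (c₁ + c₂ + 1)
  | head {env e v w c} : Eval M P env e (.cons v w) c → Eval M P env (.head e) v (c + 1)
  | tail {env e v w c} : Eval M P env e (.cons v w) c → Eval M P env (.tail e) w (c + 1)
  | add {env e₁ e₂ a b c₁ c₂} : Eval M P env e₁ (.num a) c₁ → Eval M P env e₂ (.num b) c₂ →
      Eval M P env (.add e₁ e₂) (.num (a + b)) (c₁ + c₂ + 1)
  | sub {env e₁ e₂ a b c₁ c₂} : Eval M P env e₁ (.num a) c₁ → Eval M P env e₂ (.num b) c₂ →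
      Eval M P env (.sub e₁ e₂) (.num (a - b)) (c₁ + c₂ + 1)
  | mul {env e₁ e₂ a b c₁ c₂} : Eval M P env e₁ (.num a) c₁ → Eval M P env e₂ (.num b) c₂ →
      Eval M P env (.mul e₁ e₂) (.num (a * b)) (c₁ + c₂ + 1)
  | bind {env e₁ e₂ v₁ v₂ c₁ c₂} : Eval M P env e₁ v₁ c₁ → Eval M P (v₁ :: env) e₂ v₂ c₂ →
      Eval M P env (.bind e₁ e₂) v₂ (c₁ + c₂ + 1)
  | ifNil_nil {env e e₁ e₂ v c c₁} : Eval M P env e .nil c → Eval M P env e₁ v c₁ →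
      Eval M P env (.ifNil e e₁ e₂) v (c + c₁ + 1)
  | ifNil_cons {env e e₁ e₂ a b v c c₂} : Eval M P env e (.cons a b) c → Eval M P env e₂ v c₂ →
      Eval M P env (.ifNil e e₁ e₂) v (c + c₂ + 1)
  | ifLe_true {env e₁ e₂ e₃ e₄ a b v c₁ c₂ c₃} : Eval M P env e₁ (.num a) c₁ →
      Eval M P env e₂ (.num b) c₂ → a ≤ b → Eval M P env e₃ v c₃ →
      Eval M P env (.ifLe e₁ e₂ e₃ e₄) v (c₁ + c₂ + c₃ + 1)
  | ifLe_false {env e₁ e₂ e₃ e₄ a b v c₁ c₂ c₄} : Eval M P env e₁ (.num a) c₁ →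
      Eval M P env e₂ (.num b) c₂ → ¬ a ≤ b → Eval M P env e₄ v c₄ →
      Eval M P env (.ifLe e₁ e₂ e₃ e₄) v (c₁ + c₂ + c₄ + 1)
  | ifEq_true {env e₁ e₂ e₃ e₄ i j v c₁ c₂ c₃} : Eval M P env e₁ (.vtx i) c₁ →
      Eval M P env e₂ (.vtx j) c₂ → i = j → Eval M P env e₃ v c₃ →
      Eval M P env (.ifEq e₁ e₂ e₃ e₄) v (c₁ + c₂ + c₃ + 1)
  | ifEq_false {env e₁ e₂ e₃ e₄ i j v c₁ c₂ c₄} : Eval M P env e₁ (.vtx i) c₁ →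
      Eval M P env e₂ (.vtx j) c₂ → i ≠ j → Eval M P env e₄ v c₄ →
      Eval M P env (.ifEq e₁ e₂ e₃ e₄) v (c₁ + c₂ + c₄ + 1)
  | nbrs {env e i c} : Eval M P env e (.vtx i) c →
      Eval M P env (.nbrs e) (Val.ofList .vtx (M.nbrs i)) (c + 1)
  | prior {env} : Eval M P env .prior (Val.ofPMF M.prior) 1
  | signal {env e i c} : Eval M P env e (.vtx i) c →
      Eval M P env (.signal e)
        (Val.ofList (fun s => Val.ofPMF (M.signal i s)) (List.finRange m)) (c + 1)
  | tie {env e c i t a o A} : Eval M P env e (Val.view i t a o (Val.ofFinset A)) c →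
      Eval M P env (.tie e) (Val.ofFin (M.tie i t a o A)) (c + 1)
  | call {env f e b v w c c'} : P[f]? = some b → Eval M P env e v c → Eval M P [v] b w c' →
      Eval M P env (.call f e) w (c + c' + 1)

/-- What agent `i` is given when she computes her action at time `t`: her name, the time, her
private signal and the actions of her neighbors before time `t`. -/
def input (M : Model V m k) (i : V) (x : V → Fin k) (t : ℕ) : Val V :=
  Val.view i t (x i) ((M.nbrs i).map fun j => M.traj t j x) .nil

/-- Function number `0` of the program `P`, called with argument `v`, returns `w` with `c`
elementary operations. -/
def Program.Computes (P : Program) (M : Model V m k) (v w : Val V) (c : ℕ) : Prop :=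
  Eval M P [v] (.call 0 (.var 0)) w c

end SocialLearning

end

/-! Conditioning directly on the signals of all agents within distance `t` is doubly exponential in
`t`. The tree allows dynamic programming instead. Freeze an agent `i`: let her play a fixed sequence
`τ` while all others keep their strategies. The resulting actions of a neighbor `j` (`cavity`)
depend only on the signals in the branch behind `j` (`measurable_cavity`). Hence, given the state,
the neighbors of an agent act independently of each other and of her signal, against any fixed
sequence of her actions.

Freezing loses nothing. An automaton that repeats what the agent really did reproduces the real
process (`cavity_traj`). Since actions depend on the strict past only, a sequence that is consistent
with the responses it provokes is the real one (`eq_cavity_of_eq_responses`). So the event "signal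
`a`, observations `o`" can be rewritten with the agent's own actions replaced by the constant
sequence that `a` and `o` determine (`view_eq_iff`). Its probability given the state then factors
over the neighbors (`signalLaw_cavityView`), and the unnormalized posterior is the prior times the
signal probability times a product of cavity probabilities.

The cavity probabilities obey a recursion in time (`entry_eq`): the probability that `j` plays `σ`
against `τ` for `n + 1` steps is a sum, over her signal and the possible observations that make her
play `σ`, of products of cavity probabilities for `n` steps. There are at most `k * m ^ (n * d)`
terms for each of `m * (m ^ (n + 1)) ^ 2` entries. The program recomputes tables instead of storing
them; a table triggers at most `2 * d + 1` calls one level below, so the cost is `(2 * d + 4) ^ t`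
times a fixed power of a size bound `L` that is itself `2 ^ O(t * d)`. Correctness is
`tablesCorrect`; the cost is `runs_table` and `cost_le`. -/

namespace SocialLearning

namespace Model

variable {V : Type*} {m k : ℕ} (M : Model V m k)

/-! ## Responses and cavity trajectories -/

open Classical in
/-- The action that agent `j` takes at time `t` when her signal is `a` and the past actions of her
neighbors are `o`. -/
noncomputable def response (t : ℕ) (j : V) (a : Fin k) (o : List (List (Fin m))) : Fin m :=
  M.tie j t a o (M.best {y | y j = a ∧ (M.nbrs j).map (fun l => M.traj t l y) = o})

/-- The actions of agent `j` before time `t`, as a function of her signal and of the actions of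
her neighbors before time `t` (the most recent of which are irrelevant). -/
noncomputable def responses : ℕ → V → Fin k → List (List (Fin m)) → List (Fin m)
  | 0, _, _, _ => []
  | t + 1, j, a, o =>
    M.response t j a (o.map List.tail) :: responses t j a (o.map List.tail)

open Classical in
/-- The actions of agent `j` before time `t` in the process in which agent `i` is replaced by an
automaton with actions `τ`. -/
noncomputable def cavity : ℕ → V → V → List (Fin m) → (V → Fin k) → List (Fin m)
  | 0, _, _, _, _ => []
  | t + 1, j, i, τ, y =>
    M.response t j (y j) ((M.nbrs j).map fun l =>
      if l = i then τ.tail else cavity t l j (cavity t j i τ.tail y) y) :: cavity t j i τ.tail y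

open Classical in
/-- What agent `j` observes in the cavity process when her own actions are `r`. -/
noncomputable def cavityView (t : ℕ) (j i : V) (τ r : List (Fin m)) (y : V → Fin k) :
    List (List (Fin m)) :=
  (M.nbrs j).map fun l => if l = i then τ else M.cavity t l j r y

theorem not_mem_nbrs_self (j : V) : j ∉ M.nbrs j := by
  rw [M.mem_nbrs]; exact M.graph.irrefl

theorem cavityView_succ_map_tail (t : ℕ) (j i : V) (τ r : List (Fin m)) (y : V → Fin k) :
    (M.cavityView (t + 1) j i τ r y).map List.tail = M.cavityView t j i τ.tail r.tail y := by
  simp only [cavityView, List.map_map]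
  refine List.map_congr_left fun l _ => ?_
  simp only [Function.comp]
  split_ifs
  · rfl
  · rfl

theorem cavity_succ (t : ℕ) (j i : V) (τ : List (Fin m)) (y : V → Fin k) :
    M.cavity (t + 1) j i τ y =
      M.response t j (y j) (M.cavityView t j i τ.tail (M.cavity t j i τ.tail y) y) ::
        M.cavity t j i τ.tail y := rfl

theorem cavity_eq_responses (t : ℕ) (j i : V) (τ : List (Fin m)) (y : V → Fin k) :
    M.cavity t j i τ y = M.responses t j (y j) (M.cavityView t j i τ (M.cavity t j i τ y) y) := by
  induction t generalizing τ with
  | zero => rfl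
  | succ t ih =>
    rw [responses, cavityView_succ_map_tail, cavity_succ, List.tail_cons, ← ih]

/-- The fixed point equation is causal: each action on the right depends only on the part of `r`
strictly before it. So the solution is unique, by induction on time. -/
theorem eq_cavity_of_eq_responses (t : ℕ) (j i : V) (τ r : List (Fin m)) (y : V → Fin k)
    (h : r = M.responses t j (y j) (M.cavityView t j i τ r y)) : r = M.cavity t j i τ y := by
  induction t generalizing τ r with
  | zero => exact h
  | succ t ih =>
    rw [responses, cavityView_succ_map_tail] at h
    have h2 : r.tail = M.cavity t j i τ.tail y := ih _ _ (by
      conv_lhs => rw [h]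
      rw [List.tail_cons])
    rw [cavity_succ, h, h2, ← cavity_eq_responses]

theorem traj_succ (t : ℕ) (j : V) (y : V → Fin k) :
    M.traj (t + 1) j y =
      M.response t j (y j) ((M.nbrs j).map fun l => M.traj t l y) :: M.traj t j y := by
  rw [traj, response]
  congr 4
  ext z
  simp only [List.map_inj_left, M.mem_nbrs]

/-- Replacing `j` by an automaton that plays her actual actions changes nothing for the others. -/
theorem cavity_traj (t : ℕ) (l j : V) (y : V → Fin k) :
    M.cavity t l j (M.traj t j y) y = M.traj t l y := by
  induction t generalizing l j with
  | zero => rfl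
  | succ t ih =>
    rw [cavity_succ, traj_succ, traj_succ, List.tail_cons, ih]
    congr 2
    refine List.map_congr_left fun l' _ => ?_
    split_ifs with h
    · rw [h]
    · exact ih _ _

theorem cavityView_self (t : ℕ) (j : V) (τ r : List (Fin m)) (y : V → Fin k) :
    M.cavityView t j j τ r y = (M.nbrs j).map fun l => M.cavity t l j r y := by
  refine List.map_congr_left fun l hl => ?_
  rw [if_neg]
  rintro rfl
  exact M.not_mem_nbrs_self _ hl

/-- No agent observes herself, so the frozen `τ` never enters. This makes the real process a special
case of the cavity process. -/
theorem cavity_self (t : ℕ) (j : V) (τ : List (Fin m)) (y : V → Fin k) :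
    M.cavity t j j τ y = M.traj t j y := by
  induction t generalizing τ with
  | zero => rfl
  | succ t ih =>
    rw [cavity_succ, traj_succ, ih, cavityView_self]
    simp only [cavity_traj]

theorem traj_eq_responses (t : ℕ) (j : V) (y : V → Fin k) :
    M.traj t j y = M.responses t j (y j) ((M.nbrs j).map fun l => M.traj t l y) := by
  have := M.cavity_eq_responses t j j [] y
  rwa [cavityView_self, cavity_self, List.map_congr_left fun l _ => M.cavity_traj t l j y] at this

/-- What agent `j` knows can be expressed by the cavity trajectories of her neighbors. -/
theorem view_eq_iff (t : ℕ) (j : V) (a : Fin k) (o : List (List (Fin m))) (τ : List (Fin m))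
    (y : V → Fin k) :
    (y j = a ∧ (M.nbrs j).map (fun l => M.traj t l y) = o) ↔
      (y j = a ∧ M.cavityView t j j τ (M.responses t j a o) y = o) := by
  constructor
  · rintro ⟨rfl, rfl⟩
    refine ⟨rfl, ?_⟩
    rw [← traj_eq_responses, cavityView_self]
    exact List.map_congr_left fun l _ => M.cavity_traj t l j y
  · rintro ⟨rfl, h⟩
    refine ⟨rfl, ?_⟩
    -- By `h` the computed responses are consistent with the observations they provoke, so they are
    -- the real actions of `j`.
    have h1 : M.responses t j (y j) o = M.cavity t j j τ y :=
      M.eq_cavity_of_eq_responses _ _ _ _ _ _ (by rw [h])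
    rw [cavity_self] at h1
    rw [← h, cavityView_self, h1]
    exact List.map_congr_left fun l _ => (M.cavity_traj t l j y).symm

/-- On the right the neighbors of `j` react to the constant `σ.tail` and no longer to her random
actions. This is what makes the event decomposable into independent pieces. -/
theorem cavity_succ_eq_iff (t : ℕ) (j i : V) (τ σ : List (Fin m)) (y : V → Fin k) :
    M.cavity (t + 1) j i τ y = σ ↔
      M.response t j (y j) (M.cavityView t j i τ.tail σ.tail y) ::
        M.responses t j (y j) (M.cavityView t j i τ.tail σ.tail y) = σ := by
  constructor
  · rintro rfl
    rw [cavity_succ, List.tail_cons, ← cavity_eq_responses]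
  · intro h
    have h1 : σ.tail = M.cavity t j i τ.tail y := M.eq_cavity_of_eq_responses _ _ _ _ _ _ (by
      conv_lhs => rw [← h]
      rw [List.tail_cons])
    rw [cavity_succ, ← h1]
    conv_rhs => rw [← h]
    congr 1
    rw [h1, ← cavity_eq_responses]

theorem length_traj (t : ℕ) (j : V) (y : V → Fin k) : (M.traj t j y).length = t := by
  induction t with
  | zero => rfl
  | succ t ih => rw [traj_succ, List.length_cons, ih]

theorem length_cavity (t : ℕ) (j i : V) (τ : List (Fin m)) (y : V → Fin k) :
    (M.cavity t j i τ y).length = t := by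
  induction t generalizing τ with
  | zero => rfl
  | succ t ih => rw [cavity_succ, List.length_cons, ih]

theorem length_responses (t : ℕ) (j : V) (a : Fin k) (o : List (List (Fin m))) :
    (M.responses t j a o).length = t := by
  induction t generalizing o with
  | zero => rfl
  | succ t ih => rw [responses, List.length_cons, ih]

/-! ## Branches of the tree -/

/-- The vertices that are reached from `i` through its neighbor `j`. -/
def branch (j i : V) : Set V :=
  {v | ∃ (h : M.graph.Adj i j) (p : M.graph.Walk j v), (SimpleGraph.Walk.cons h p).IsPath}

variable {M}

theorem not_mem_branch (j i : V) : i ∉ M.branch j i := by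
  rintro ⟨h, p, hp⟩
  rw [SimpleGraph.Walk.cons_isPath_iff] at hp
  exact hp.2 p.end_mem_support

theorem mem_branch {j i : V} (h : M.graph.Adj i j) : j ∈ M.branch j i :=
  ⟨h, .nil, by simpa using h.ne⟩

/-- A path from `j` through `l` cannot meet `i`: its initial segment would be a second path from `j`
to `i`, besides the edge. So it can be prolonged to `i`. -/
theorem branch_subset (hM : M.graph.IsTree) {i j l : V} (h : M.graph.Adj i j) (hl : l ≠ i) :
    M.branch l j ⊆ M.branch j i := by
  classical
  rintro v ⟨hjl, p, hp⟩
  refine ⟨h, .cons hjl p, ?_⟩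
  rw [SimpleGraph.Walk.cons_isPath_iff]
  refine ⟨hp, fun hi => ?_⟩
  have h1 : ((SimpleGraph.Walk.cons hjl p).takeUntil i hi).IsPath := hp.takeUntil hi
  have h2 : (SimpleGraph.Walk.cons h.symm .nil).IsPath := by simpa using h.ne'
  have h3 := (hM.existsUnique_path j i).unique h1 h2
  rw [SimpleGraph.Walk.takeUntil_cons (by
      simp only [SimpleGraph.Walk.support_cons, List.mem_cons] at hi
      exact hi.resolve_left h.ne) h.ne'] at h3
  simp only [SimpleGraph.Walk.cons.injEq] at h3
  exact hl h3.1

/-- The path from `j` to a common vertex is unique, so it has only one first step. -/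
theorem disjoint_branch (hM : M.graph.IsTree) {j l l' : V} (h : l ≠ l') :
    Disjoint (M.branch l j) (M.branch l' j) := by
  rw [Set.disjoint_left]
  rintro v ⟨h1, p, hp⟩ ⟨h2, q, hq⟩
  have h3 := (hM.existsUnique_path j v).unique hp hq
  simp only [SimpleGraph.Walk.cons.injEq] at h3
  exact h h3.1

end Model

end SocialLearning

namespace SocialLearning

/-! ## Random variables that depend on some of the coordinates -/

section Coordinates

variable {V : Type*} {k : ℕ}

/-- The events that depend on the signals of the vertices in `D`. -/
abbrev coordinates (k : ℕ) (D : Set V) : MeasurableSpace (V → Fin k) :=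
  ⨆ v ∈ D, MeasurableSpace.comap (fun y => y v) ⊤

theorem coordinates_mono {D D' : Set V} (h : D ⊆ D') : coordinates k D ≤ coordinates k D' :=
  biSup_mono h

theorem coordinates_le (D : Set V) : coordinates k D ≤ MeasurableSpace.pi :=
  iSup₂_le fun v _ => (measurable_pi_apply v).comap_le

theorem measurable_coordinate {D : Set V} {v : V} (hv : v ∈ D) :
    Measurable[coordinates k D, ⊤] fun y : V → Fin k => y v :=
  (comap_measurable (m := ⊤) (fun y : V → Fin k => y v)).mono
    (le_iSup₂_of_le (f := fun v _ => MeasurableSpace.comap (fun y : V → Fin k => y v) ⊤) v hv le_rfl)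
    le_rfl

variable {Ω β γ δ : Type*} {mΩ : MeasurableSpace Ω}

/-- Allows a random sequence to be inserted as the parameter of a cavity trajectory: split according
to its countably many values. -/
theorem Measurable.bind_top [Countable β] {f : Ω → β} {F : β → Ω → γ}
    (hf : Measurable[mΩ, ⊤] f) (hF : ∀ b, Measurable[mΩ, ⊤] (F b)) :
    Measurable[mΩ, ⊤] fun y => F (f y) y := by
  intro S _
  have : (fun y => F (f y) y) ⁻¹' S = ⋃ b, f ⁻¹' {b} ∩ F b ⁻¹' S := by
    ext y
    simp
  rw [this]
  exact MeasurableSet.iUnion fun b =>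
    (hf (MeasurableSpace.measurableSet_top)).inter (hF b (MeasurableSpace.measurableSet_top))

theorem Measurable.comp_top {f : Ω → β} (g : β → γ) (hf : Measurable[mΩ, ⊤] f) :
    Measurable[mΩ, ⊤] fun y => g (f y) :=
  fun S _ => hf (MeasurableSpace.measurableSet_top (s := g ⁻¹' S))

theorem Measurable.map₂_top [Countable β] {f : Ω → β} {f' : Ω → γ} (g : β → γ → δ)
    (hf : Measurable[mΩ, ⊤] f) (hf' : Measurable[mΩ, ⊤] f') :
    Measurable[mΩ, ⊤] fun y => g (f y) (f' y) :=
  Measurable.bind_top (F := fun b y => g b (f' y)) hf fun b => Measurable.comp_top (g b) hf'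

theorem Measurable.list_map_top [Countable γ] {F : β → Ω → γ} (L : List β)
    (h : ∀ l ∈ L, Measurable[mΩ, ⊤] (F l)) : Measurable[mΩ, ⊤] fun y => L.map fun l => F l y := by
  induction L with
  | nil => exact @measurable_const _ _ ⊤ mΩ _
  | cons l L ih =>
    simp only [List.map_cons]
    exact Measurable.map₂_top _ (h _ (by simp)) (ih fun l' hl' => h _ (by simp [hl']))

end Coordinates

/-- The law of a random variable with finitely many values. -/
theorem measureReal_eq_list_sum {Ω β : Type*} {mΩ : MeasurableSpace Ω} {μ : Measure Ω}
    [IsFiniteMeasure μ] {f : Ω → β} (hf : Measurable[mΩ, ⊤] f) {l : List β} (hl : l.Nodup)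
    {A : Set Ω} (hA : MeasurableSet A) (h : ∀ y ∈ A, f y ∈ l) :
    μ.real A = (l.map fun b => μ.real (A ∩ {y | f y = b})).sum := by
  classical
  have hm : ∀ b, MeasurableSet (A ∩ {y | f y = b}) := fun b =>
    hA.inter (hf (MeasurableSpace.measurableSet_top (s := {b})))
  rw [← List.sum_toFinset _ hl, ← measureReal_biUnion_finset _ fun b _ => hm b]
  · congr 1
    ext y
    simp only [Set.mem_iUnion, List.mem_toFinset, Set.mem_inter_iff, exists_prop]
    exact ⟨fun hy => ⟨_, h y hy, hy, rfl⟩, fun ⟨_, _, hy, _⟩ => hy⟩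
  · intro b _ b' _ hb
    refine Set.disjoint_left.2 fun y hy hy' => hb ?_
    exact hy.2.symm.trans hy'.2

/-! ### Unnormalized posteriors and conditional independence over branches -/

namespace Model

variable {V : Type*} {m k : ℕ} (M : Model V m k)

/-- The law of the private signals given the state. -/
noncomputable def signalLaw (s : Fin m) : Measure (V → Fin k) :=
  Measure.infinitePi fun v => (M.signal v s).toMeasure

instance (s : Fin m) : IsProbabilityMeasure (M.signalLaw s) := by
  unfold signalLaw; infer_instance

theorem signalLaw_coordinate (s : Fin m) (j : V) (a : Fin k) :
    (M.signalLaw s).real {y | y j = a} = (M.signal j s a).toReal := by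
  have h := Measure.infinitePi_map_eval (fun v => (M.signal v s).toMeasure) j
  have : M.signalLaw s {y | y j = a} = M.signal j s a := by
    rw [← PMF.toMeasure_apply_singleton (M.signal j s) a (measurableSet_singleton a), ← h,
      Measure.map_apply (by fun_prop) (measurableSet_singleton a)]
    rfl
  rw [measureReal_def, this]

theorem signalLaw_inter (s : Fin m) {D D' : Set V} (hD : Disjoint D D') {A B : Set (V → Fin k)}
    (hA : MeasurableSet[coordinates k D] A) (hB : MeasurableSet[coordinates k D'] B) :
    (M.signalLaw s).real (A ∩ B) = (M.signalLaw s).real A * (M.signalLaw s).real B := by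
  have h : iIndepFun (fun v (y : V → Fin k) => y v) (M.signalLaw s) :=
    iIndepFun_infinitePi (X := fun _ x => x) fun _ => measurable_id
  have h2 := indep_iSup_of_disjoint (fun v => (measurable_pi_apply v).comap_le) h.iIndep hD
  rw [Indep_iff] at h2
  rw [measureReal_def, h2 A B hA hB, ENNReal.toReal_mul]
  rfl

theorem law_prod (s : Fin m) (E : Set (V → Fin k)) :
    M.law (Prod.snd ⁻¹' E ∩ Prod.fst ⁻¹' {s}) = M.prior s * M.signalLaw s E := by
  have : (Prod.snd ⁻¹' E ∩ Prod.fst ⁻¹' {s} : Set (Fin m × (V → Fin k))) = {s} ×ˢ E := by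
    ext; simp [and_comm]
  rw [this, law, Measure.finsetSum_apply, Finset.sum_eq_single s]
  · rw [Measure.smul_apply, Measure.prod_prod, Measure.dirac_apply' _ (measurableSet_singleton s)]
    simp [signalLaw]
  · intro s' _ h
    rw [Measure.smul_apply, Measure.prod_prod, Measure.dirac_apply' _ (measurableSet_singleton s)]
    simp [h]
  · simp

instance : IsFiniteMeasure M.law := by
  constructor
  rw [law, Measure.finsetSum_apply]
  refine ENNReal.sum_lt_top.2 fun s _ => ?_
  rw [Measure.smul_apply, smul_eq_mul]
  exact ENNReal.mul_lt_top (M.prior.apply_lt_top s) (measure_lt_top _ _)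

/-- Posterior probabilities may be compared without normalization. -/
theorem mem_best_iff {E : Set (V → Fin k)} (hE : MeasurableSet E) (s : Fin m) :
    s ∈ M.best E ↔ ∀ s', (M.prior s').toReal * (M.signalLaw s').real E ≤
      (M.prior s).toReal * (M.signalLaw s).real E := by
  have hE' : MeasurableSet (Prod.snd ⁻¹' E : Set (Fin m × (V → Fin k))) := measurable_snd hE
  have key : ∀ s s', M.posterior E s' ≤ M.posterior E s ↔
      M.prior s' * M.signalLaw s' E ≤ M.prior s * M.signalLaw s E := by
    intro s s'
    rw [posterior, posterior, cond_apply hE', cond_apply hE', law_prod, law_prod]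
    -- On a null event all the products vanish, so every state is maximal on both sides.
    by_cases h0 : M.law (Prod.snd ⁻¹' E) = 0
    · have h : ∀ s, M.prior s * M.signalLaw s E = 0 := fun s => by
        rw [← law_prod]
        exact measure_mono_null Set.inter_subset_left h0
      rw [h, h]
      simp
    · exact ENNReal.mul_le_mul_iff_right (ENNReal.inv_ne_zero.2 (measure_ne_top _ _))
        (ENNReal.inv_ne_top.2 h0)
  unfold best
  rw [Finset.mem_filter]
  simp only [Finset.mem_univ, true_and, key]
  refine forall_congr' fun s' => ?_
  rw [← ENNReal.toReal_le_toReal, ENNReal.toReal_mul, ENNReal.toReal_mul]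
  · rfl
  · exact ENNReal.mul_ne_top (PMF.apply_ne_top _ _) (measure_ne_top _ _)
  · exact ENNReal.mul_ne_top (PMF.apply_ne_top _ _) (measure_ne_top _ _)

variable {M}

/-- Agent `j` uses her own signal and observes `i`, who is frozen, and neighbors `l ≠ i`, whose
branches lie inside that of `j`. -/
theorem measurable_cavity (hM : M.graph.IsTree) (t : ℕ) {j i : V} (h : M.graph.Adj i j)
    (τ : List (Fin m)) :
    Measurable[coordinates k (M.branch j i), ⊤] (M.cavity t j i τ) := by
  induction t generalizing j i τ with
  | zero => exact @measurable_const _ _ ⊤ (coordinates k (M.branch j i)) []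
  | succ t ih =>
    refine Measurable.map₂_top (fun b r => b :: r) ?_ (ih h τ.tail)
    refine Measurable.map₂_top (fun a o => M.response t j a o) ?_ ?_
    · exact measurable_coordinate (mem_branch h)
    · refine Measurable.list_map_top _ fun l hl => ?_
      rw [M.mem_nbrs] at hl
      split_ifs with hi
      · exact @measurable_const _ _ ⊤ (coordinates k (M.branch j i)) τ.tail
      -- The neighbor `l` reacts to random actions of `j`; these depend on the branch of `j`, and
      -- for each fixed value the trajectory of `l` depends on a smaller branch.
      · exact Measurable.bind_top (ih h τ.tail) fun r =>
          (ih hl r).mono (coordinates_mono (branch_subset hM h hi)) le_rfl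

open Classical in
/-- Given the state and the signal of `j`, the cavity trajectories of the neighbors of `j` are
independent. -/
theorem signalLaw_cavityView (hM : M.graph.IsTree) (s : Fin m) (t : ℕ) (j i : V) (a : Fin k)
    (τ r : List (Fin m)) {L : List V} {o : List (List (Fin m))} (hL : L.Nodup)
    (hadj : ∀ l ∈ L, M.graph.Adj j l) (ho : List.Forall₂ (fun l ρ => l = i → ρ = τ) L o) :
    (M.signalLaw s).real ({y | y j = a} ∩
        {y | (L.map fun l => if l = i then τ else M.cavity t l j r y) = o}) =
      (M.signal j s a).toReal * (List.zipWith (fun l ρ =>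
        if l = i then 1 else (M.signalLaw s).real {y | M.cavity t l j r y = ρ}) L o).prod := by
  induction ho with
  | nil => simp [signalLaw_coordinate]
  | @cons l ρ L o hρ ho ih =>
    rw [List.nodup_cons] at hL
    specialize ih hL.2 fun l' hl' => hadj l' (by simp [hl'])
    rw [List.zipWith_cons_cons, List.prod_cons]
    by_cases hi : l = i
    · simp only [List.map_cons, hi, if_true, hρ hi, List.cons.injEq, true_and, one_mul, ih]
    · simp only [List.map_cons, hi, if_false, List.cons.injEq]
      have h1 : ({y | y j = a} ∩ {y | M.cavity t l j r y = ρ ∧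
            (L.map fun l => if l = i then τ else M.cavity t l j r y) = o} : Set (V → Fin k)) =
          {y | M.cavity t l j r y = ρ} ∩ ({y | y j = a} ∩
            {y | (L.map fun l => if l = i then τ else M.cavity t l j r y) = o}) := by
        ext y; simp only [Set.mem_inter_iff]; exact and_left_comm
      -- The first neighbor is split off: her branch is disjoint from `j` and from the branches of
      -- the remaining neighbors.
      rw [h1, M.signalLaw_inter s (D := M.branch l j) (D' := {j} ∪ ⋃ l' ∈ L, M.branch l' j), ih]
      · ring
      · rw [Set.disjoint_union_right, Set.disjoint_iUnion₂_right]
        refine ⟨Set.disjoint_singleton_right.2 (not_mem_branch _ _), fun l' hl' => ?_⟩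
        exact disjoint_branch hM fun h => hL.1 (h ▸ hl')
      · exact measurable_cavity hM t (hadj l (by simp)) r
          (MeasurableSpace.measurableSet_top (s := {ρ}))
      · refine MeasurableSet.inter ?_ ?_
        · exact measurable_coordinate (D := {j} ∪ ⋃ l' ∈ L, M.branch l' j) (Or.inl rfl)
            (MeasurableSpace.measurableSet_top (s := {a}))
        · refine Measurable.list_map_top L (fun l' hl' => ?_)
            (MeasurableSpace.measurableSet_top (s := {o}))
          split_ifs
          · exact @measurable_const _ _ ⊤ (coordinates k _) τ
          · refine (measurable_cavity hM t (hadj l' (by simp [hl'])) r).mono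
              (coordinates_mono ?_) le_rfl
            exact (Set.subset_biUnion_of_mem (u := fun l' => M.branch l' j) hl').trans
              Set.subset_union_right

theorem measurable_cavityView (hM : M.graph.IsTree) (t : ℕ) (j i : V) (τ r : List (Fin m)) :
    Measurable[MeasurableSpace.pi, ⊤] (M.cavityView (k := k) t j i τ r) := by
  refine Measurable.list_map_top _ fun l hl => ?_
  split_ifs
  · exact @measurable_const _ _ ⊤ MeasurableSpace.pi τ
  · exact (measurable_cavity hM t ((M.mem_nbrs _ _).1 hl) r).mono (coordinates_le _) le_rfl

end Model

end SocialLearning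

namespace SocialLearning

/-! ## The dynamic cavity algorithm -/

/-- Real numbers indexed by lists of actions. -/
abbrev Table (m : ℕ) := List (List (Fin m) × ℝ)

variable {V : Type*} {m k : ℕ}

/-- The value of the first entry with a given key, and `1` if there is none. -/
noncomputable def Table.lookup (T : Table m) (key : List (Fin m)) : ℝ :=
  T.foldr (fun e b => if e.1 = key then e.2 else b) 1

theorem Table.lookup_append_of_forall {T : Table m} (T' : Table m) {key : List (Fin m)} {q : ℝ}
    (h : ∀ e ∈ T, e.1 = key → e.2 = q) (h' : ∃ e ∈ T, e.1 = key) :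
    Table.lookup (T ++ T') key = q := by
  induction T with
  | nil => simp at h'
  | cons e T ih =>
    simp only [lookup, List.cons_append, List.foldr_cons]
    split_ifs with he
    · exact h e (by simp) he
    · refine ih (fun e he => h e (by simp [he])) ?_
      obtain ⟨e', h1, h2⟩ := h'
      rcases List.mem_cons.1 h1 with rfl | h1
      · exact absurd h2 he
      · exact ⟨e', h1, h2⟩

theorem Table.lookup_append_of_ne {T : Table m} (T' : Table m) {key : List (Fin m)}
    (h : ∀ e ∈ T, e.1 ≠ key) : Table.lookup (T ++ T') key = Table.lookup T' key := by
  induction T with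
  | nil => rfl
  | cons e T ih =>
    simp only [lookup, List.cons_append, List.foldr_cons]
    rw [if_neg (h e (by simp))]
    exact ih fun e he => h e (by simp [he])

/-- The likelihood of the actions `o` of the neighbors in the state `s` against the own actions
`r`. -/
noncomputable def likelihood (s : Fin m) (r : List (Fin m)) (TL : List (Table m))
    (o : List (List (Fin m))) : ℝ :=
  (List.zipWith (fun T ρ => Table.lookup T (s :: (ρ ++ r))) TL o).prod

theorem likelihood_eq_one (s : Fin m) (r : List (Fin m)) {TL : List (Table m)}
    (o : List (List (Fin m))) (h : ∀ T ∈ TL, T = []) : likelihood s r TL o = 1 := by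
  induction TL generalizing o with
  | nil => simp [likelihood]
  | cons T TL ih =>
    cases o with
    | nil => simp [likelihood]
    | cons ρ o =>
      have := ih o fun T hT => h T (by simp [hT])
      rw [likelihood] at this ⊢
      rw [List.zipWith_cons_cons, List.prod_cons, this, h T (by simp)]
      simp [Table.lookup]

/-- The sequences of `n` actions. -/
def sequences (m n : ℕ) : List (List (Fin m)) :=
  (List.replicate n (List.finRange m)).sections

theorem mem_sequences {n : ℕ} {l : List (Fin m)} : l ∈ sequences m n ↔ l.length = n := by
  rw [sequences, List.mem_sections]
  constructor
  · intro h
    simpa using h.length_eq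
  · rintro rfl
    induction l with
    | nil => exact .nil
    | cons a l ih => exact .cons (List.mem_finRange a) ih

theorem nodup_sections {α : Type*} (L : List (List α)) (h : ∀ l ∈ L, l.Nodup) :
    L.sections.Nodup := by
  induction L with
  | nil => simp
  | cons l L ih =>
    rw [List.sections, List.nodup_flatMap]
    refine ⟨fun s _ => (h l (by simp)).map fun a b hab => (List.cons.inj hab).1, ?_⟩
    refine (ih fun l hl => h l (by simp [hl])).imp fun {s s'} hs => ?_
    simp only [Function.onFun, List.disjoint_left, List.mem_map]
    rintro _ ⟨a, _, rfl⟩ ⟨b, _, hb⟩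
    exact hs (List.cons.inj hb).2.symm

theorem nodup_sequences (n : ℕ) : (sequences m n).Nodup :=
  nodup_sections _ fun l hl => by
    rw [List.eq_of_mem_replicate hl]; exact List.nodup_finRange m

/-- The states at which a nonnegative function is maximal. -/
noncomputable def maximizers (w : Fin m → ℝ) : Finset (Fin m) := by
  classical exact Finset.univ.filter fun s => ((List.finRange m).map w).foldr max 0 ≤ w s

theorem foldr_max_le_iff (l : List ℝ) (b c : ℝ) :
    l.foldr max b ≤ c ↔ b ≤ c ∧ ∀ a ∈ l, a ≤ c := by
  induction l with
  | nil => simp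
  | cons a l ih => simp [ih]; tauto

theorem mem_maximizers {w : Fin m → ℝ} {s : Fin m} (hw : 0 ≤ w s) :
    s ∈ maximizers w ↔ ∀ s', w s' ≤ w s := by
  simp [maximizers, foldr_max_le_iff, hw]

namespace Model

variable (M : Model V m k)

/-- The unnormalized posterior probability of the state `s` for agent `j`, computed from the tables
of her neighbors. -/
noncomputable def weight (j : V) (a : Fin k) (TL : List (Table m)) (o : List (List (Fin m)))
    (r : List (Fin m)) (s : Fin m) : ℝ :=
  likelihood s r TL o * ((M.prior s).toReal * (M.signal j s a).toReal)

/-- The action of agent `j` at time `t`, computed from the tables of her neighbors. -/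
noncomputable def tableAction (t : ℕ) (j : V) (a : Fin k) (TL : List (Table m))
    (o : List (List (Fin m))) (r : List (Fin m)) : Fin m :=
  M.tie j t a o (maximizers (M.weight j a TL o r))

/-- The actions of agent `j` up to time `t`, computed from the tables of her neighbors. -/
noncomputable def tableActions : ℕ → V → Fin k → List (Table m) → List (List (Fin m)) →
    List (Fin m)
  | 0, j, a, TL, o => [M.tableAction 0 j a TL o []]
  | t + 1, j, a, TL, o =>
    M.tableAction (t + 1) j a TL o (tableActions t j a TL (o.map List.tail)) ::
      tableActions t j a TL (o.map List.tail)

open Classical in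
/-- The possible past actions of the neighbors of `j`, where those of `i` are given. -/
noncomputable def views (j i : V) (τ : List (Fin m)) (n : ℕ) : List (List (List (Fin m))) :=
  ((M.nbrs j).map fun l => if l = i then [τ] else sequences m n).sections

open Classical in
/-- The probability that agent `j` takes the actions `σ` against the actions `τ` of `i` in the
state `s`, computed from tables. -/
noncomputable def entry (n : ℕ) (j i : V) (TL TL' : List (Table m)) (s : Fin m)
    (σ τ : List (Fin m)) : ℝ :=
  ((List.finRange k).map fun a => ((M.views j i τ.tail n).map fun o =>
    if M.tableActions n j a TL o = σ then
      (M.signal j s a).toReal * likelihood s σ.tail TL' o else 0).sum).sum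

/-- The entries for sequences of `n + 1` actions. -/
noncomputable def entries (n : ℕ) (j i : V) (TL TL' : List (Table m)) : Table m :=
  (List.finRange m).flatMap fun s => (sequences m (n + 1)).flatMap fun σ =>
    (sequences m (n + 1)).map fun τ => (s :: (σ ++ τ), M.entry n j i TL TL' s σ τ)

open Classical in
/-- The table of the cavity probabilities of agent `j` against agent `i` for at most `n` actions. -/
noncomputable def table : ℕ → V → V → Table m
  | 0, _, _ => []
  | n + 1, j, i =>
    M.entries n j i ((M.nbrs j).map fun l => if l = j then [] else table n l j)
      ((M.nbrs j).map fun l => if l = i then [] else table n l j) ++ table n j i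

open Classical in
/-- The tables of the neighbors of `j`, that of `i` excepted. -/
noncomputable def tables (n : ℕ) (j i : V) : List (Table m) :=
  (M.nbrs j).map fun l => if l = i then [] else M.table n l j

theorem table_succ (n : ℕ) (j i : V) :
    M.table (n + 1) j i = M.entries n j i (M.tables n j j) (M.tables n j i) ++ M.table n j i := rfl

/-! ### Correctness -/

/-- The tables contain the cavity probabilities. -/
def TablesCorrect (n : ℕ) : Prop :=
  ∀ ⦃j i : V⦄, M.graph.Adj i j → ∀ ⦃t : ℕ⦄, t ≤ n → ∀ ⦃σ τ : List (Fin m)⦄, σ.length = t →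
    τ.length = t → ∀ s, Table.lookup (M.table n j i) (s :: (σ ++ τ)) =
      (M.signalLaw s).real {y | M.cavity t j i τ y = σ}

variable {M}

/-- The excepted neighbor has an empty table, where the default value of `Table.lookup` is exactly
the required factor `1`. -/
theorem likelihood_tables {n : ℕ} (hn : M.TablesCorrect n) (s : Fin m) {t : ℕ} (ht : t ≤ n)
    (j i : V) {r : List (Fin m)} (hr : r.length = t) {o : List (List (Fin m))}
    (ho : ∀ ρ ∈ o, ρ.length = t) :
    likelihood s r (M.tables n j i) o = (by classical exact (List.zipWith (fun l ρ =>
        if l = i then 1 else (M.signalLaw s).real {y | M.cavity t l j r y = ρ}) (M.nbrs j) o).prod) := by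
  rw [likelihood, tables]
  have h : ∀ l ∈ M.nbrs j, M.graph.Adj j l := fun l hl => (M.mem_nbrs _ _).1 hl
  generalize M.nbrs j = L at h
  induction L generalizing o with
  | nil => rfl
  | cons l L ih =>
    cases o with
    | nil => rfl
    | cons ρ o =>
      simp only [List.map_cons, List.zipWith_cons_cons, List.prod_cons]
      rw [ih (fun ρ hρ => ho ρ (by simp [hρ])) fun l hl => h l (by simp [hl])]
      congr 1
      split_ifs
      · rfl
      · exact hn (h l (by simp)) ht (ho ρ (by simp)) hr s

theorem signalLaw_view (hM : M.graph.IsTree) {n : ℕ} (hn : M.TablesCorrect n) (s : Fin m) {t : ℕ}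
    (ht : t ≤ n) (j i : V) (a : Fin k) (τ : List (Fin m)) {r : List (Fin m)} (hr : r.length = t)
    {o : List (List (Fin m))} (ho : ∀ ρ ∈ o, ρ.length = t)
    (ho' : List.Forall₂ (fun l ρ => l = i → ρ = τ) (M.nbrs j) o) :
    (M.signalLaw s).real ({y | y j = a} ∩ {y | M.cavityView t j i τ r y = o}) =
      (M.signal j s a).toReal * likelihood s r (M.tables n j i) o := by
  rw [likelihood_tables hn s ht j i hr ho]
  exact signalLaw_cavityView hM s t j i a τ r (M.nodup_nbrs j)
    (fun l hl => (M.mem_nbrs _ _).1 hl) ho'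

/-- `view_eq_iff` turns the information of `j` into a cavity event against her own responses, and
its probability in each state times the prior is `weight`. The two maximizations therefore agree. -/
theorem tableAction_eq (hM : M.graph.IsTree) {n : ℕ} (hn : M.TablesCorrect n) {t : ℕ} (ht : t ≤ n)
    (j : V) (a : Fin k) {o : List (List (Fin m))} (ho : ∀ ρ ∈ o, ρ.length = t)
    (ho' : o.length = (M.nbrs j).length) :
    M.tableAction t j a (M.tables n j j) o (M.responses t j a o) = M.response t j a o := by
  rw [tableAction, response]
  congr 1
  have hE : {y | y j = a ∧ (M.nbrs j).map (fun l => M.traj t l y) = o} =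
      {y | y j = a} ∩ {y | M.cavityView t j j [] (M.responses t j a o) y = o} := by
    ext y
    exact M.view_eq_iff t j a o [] y
  have hmeas : MeasurableSet ({y | y j = a} ∩
      {y | M.cavityView t j j [] (M.responses t j a o) y = o} : Set (V → Fin k)) :=
    (measurableSet_eq_fun (measurable_pi_apply j) measurable_const).inter
      (measurable_cavityView hM t j j [] _ (MeasurableSpace.measurableSet_top (s := {o})))
  have hadm : List.Forall₂ (fun l ρ => l = j → ρ = ([] : List (Fin m))) (M.nbrs j) o := by
    rw [List.forall₂_iff_zip]
    refine ⟨ho'.symm, fun {l ρ} h hl => ?_⟩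
    exact absurd (List.of_mem_zip h).1 (hl ▸ M.not_mem_nbrs_self j)
  have hw : ∀ s, M.weight j a (M.tables n j j) o (M.responses t j a o) s =
      (M.prior s).toReal * (M.signalLaw s).real ({y | y j = a} ∩
        {y | M.cavityView t j j [] (M.responses t j a o) y = o}) := fun s => by
    rw [weight, signalLaw_view hM hn s ht j j a [] (M.length_responses t j a o) ho hadm]
    ring
  ext s
  rw [mem_maximizers, hE, M.mem_best_iff hmeas]
  · simp only [hw]
  · rw [hw]; positivity

theorem tableActions_eq (hM : M.graph.IsTree) {n : ℕ} (hn : M.TablesCorrect n) {t : ℕ} (ht : t ≤ n)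
    (j : V) (a : Fin k) {o : List (List (Fin m))} (ho : ∀ ρ ∈ o, ρ.length = t)
    (ho' : o.length = (M.nbrs j).length) :
    M.tableActions t j a (M.tables n j j) o = M.response t j a o :: M.responses t j a o := by
  induction t generalizing o with
  | zero =>
    rw [tableActions]
    congr 1
    exact tableAction_eq hM hn ht j a ho ho'
  | succ t ih =>
    have h1 := ih (by omega) (o := o.map List.tail) (by
      simp only [List.mem_map]
      rintro _ ⟨ρ, hρ, rfl⟩
      simp [ho ρ hρ]) (by simpa using ho')
    have h2 : M.responses (t + 1) j a o =
        M.response t j a (o.map List.tail) :: M.responses t j a (o.map List.tail) := rfl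
    rw [tableActions, h1, ← h2, tableAction_eq hM hn ht j a ho ho']

theorem mem_views {j i : V} {τ : List (Fin m)} {n : ℕ} {o : List (List (Fin m))} :
    o ∈ M.views j i τ n ↔
      List.Forall₂ (fun l ρ => (l = i → ρ = τ) ∧ (l ≠ i → ρ.length = n)) (M.nbrs j) o := by
  classical
  rw [views, List.mem_sections, List.forall₂_map_right_iff]
  have key : ∀ (l : V) (ρ : List (Fin m)), (ρ ∈ if l = i then [τ] else sequences m n) ↔
      (l = i → ρ = τ) ∧ (l ≠ i → ρ.length = n) := by
    intro l ρ
    split_ifs with hl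
    · simp [hl]
    · simp [hl, mem_sequences]
  simp only [key]
  exact ⟨List.Forall₂.flip, List.Forall₂.flip⟩

theorem nodup_views (j i : V) (τ : List (Fin m)) (n : ℕ) : (M.views j i τ n).Nodup := by
  refine nodup_sections _ fun l hl => ?_
  obtain ⟨l, -, rfl⟩ := List.mem_map.1 hl
  split_ifs
  · simp
  · exact nodup_sequences n

theorem cavityView_mem_views (t : ℕ) (j i : V) (τ r : List (Fin m)) (y : V → Fin k) :
    M.cavityView t j i τ r y ∈ M.views j i τ t := by
  rw [mem_views, cavityView, List.forall₂_map_right_iff, List.forall₂_same]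
  intro l _
  refine ⟨fun h => by simp [h], fun h => ?_⟩
  rw [if_neg h, length_cavity]

/-- The law of total probability over the signal of `j` and her observations against the constants
`τ.tail` and `σ.tail`. A signal and a view determine her actions: if these are `σ`, the event is the
whole cell, otherwise it misses the cell. The last entry of `τ` is never used, as `j` would see it
one step too late. -/
theorem entry_eq (hM : M.graph.IsTree) {n : ℕ} (hn : M.TablesCorrect n) {j i : V}
    (h : M.graph.Adj i j) (s : Fin m) {σ τ : List (Fin m)} (hσ : σ.length = n + 1)
    (hτ : τ.length = n + 1) :
    M.entry n j i (M.tables n j j) (M.tables n j i) s σ τ =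
      (M.signalLaw s).real {y | M.cavity (n + 1) j i τ y = σ} := by
  have hA : MeasurableSet {y | M.cavity (n + 1) j i τ y = σ} :=
    coordinates_le _ _ (measurable_cavity hM (n + 1) h τ
      (MeasurableSpace.measurableSet_top (s := {σ})))
  have hj : Measurable[MeasurableSpace.pi, ⊤] fun y : V → Fin k => y j :=
    (measurable_coordinate (Set.mem_univ j)).mono (coordinates_le _) le_rfl
  rw [measureReal_eq_list_sum hj (List.nodup_finRange k) hA fun y _ => List.mem_finRange _, entry]
  congr 1
  refine List.map_congr_left fun a _ => ?_
  refine Eq.trans ?_ (measureReal_eq_list_sum (measurable_cavityView hM n j i τ.tail σ.tail)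
    (nodup_views j i τ.tail n) (hA.inter (hj (MeasurableSpace.measurableSet_top (s := {a}))))
    fun y _ => cavityView_mem_views n j i τ.tail σ.tail y).symm
  congr 1
  refine List.map_congr_left fun o ho => ?_
  rw [mem_views] at ho
  have hlen : o.length = (M.nbrs j).length := ho.length_eq.symm
  have hτ' : τ.tail.length = n := by simp [hτ]
  have ho1 : ∀ ρ ∈ o, ρ.length = n := by
    intro ρ hρ
    obtain ⟨q, hq, rfl⟩ := List.getElem_of_mem hρ
    have := ho.get (i := q) (by omega) (by omega)
    by_cases hi : (M.nbrs j).get ⟨q, by omega⟩ = i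
    · have := this.1 hi
      simp only [List.get_eq_getElem] at this
      rw [this, hτ']
    · exact this.2 hi
  rw [tableActions_eq hM hn le_rfl j a ho1 hlen]
  split_ifs with hif
  -- Her decisions are computed from the tables of all neighbors, but the likelihood omits `i`,
  -- whose actions are prescribed.
  · rw [← signalLaw_view hM hn s le_rfl j i a τ.tail (by simp [hσ]) ho1 (ho.imp fun _ _ h => h.1)]
    congr 1
    ext y
    simp only [Set.mem_inter_iff]
    constructor
    · rintro ⟨h1, h2⟩
      refine ⟨⟨?_, h1⟩, h2⟩
      refine (M.cavity_succ_eq_iff n j i τ σ y).2 ?_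
      have h1 : y j = a := h1
      have h2 : M.cavityView n j i τ.tail σ.tail y = o := h2
      rw [h1, h2, hif]
    · rintro ⟨⟨_, h1⟩, h2⟩
      exact ⟨h1, h2⟩
  · symm
    rw [measureReal_def]
    convert ENNReal.toReal_zero
    convert measure_empty (μ := M.signalLaw s)
    rw [Set.eq_empty_iff_forall_notMem]
    rintro y ⟨⟨h0, h1⟩, h2⟩
    have h0 := (M.cavity_succ_eq_iff n j i τ σ y).1 h0
    have h1 : y j = a := h1
    have h2 : M.cavityView n j i τ.tail σ.tail y = o := h2
    rw [h1, h2] at h0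
    exact hif h0

theorem mem_entries {n : ℕ} {j i : V} {TL TL' : List (Table m)} {e : List (Fin m) × ℝ} :
    e ∈ M.entries n j i TL TL' ↔ ∃ s σ τ, σ.length = n + 1 ∧ τ.length = n + 1 ∧
      e = (s :: (σ ++ τ), M.entry n j i TL TL' s σ τ) := by
  simp only [entries, List.mem_flatMap, List.mem_map, mem_sequences, List.mem_finRange, true_and]
  constructor
  · rintro ⟨s, σ, h1, τ, h2, rfl⟩
    exact ⟨s, σ, τ, h1, h2, rfl⟩
  · rintro ⟨s, σ, τ, h1, h2, rfl⟩
    exact ⟨s, σ, h1, τ, h2, rfl⟩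

/-- All lengths `t ≤ n` are needed, because the decisions of an agent at earlier times are
recomputed from the same table. -/
theorem tablesCorrect (hM : M.graph.IsTree) (n : ℕ) : M.TablesCorrect n := by
  induction n with
  | zero =>
    rintro j i - t ht σ τ hσ hτ s
    obtain rfl : t = 0 := by omega
    obtain rfl := List.length_eq_zero_iff.1 hσ
    -- For sequences of length `0` the event is certain, which again agrees with the default value
    -- `1`.
    simp [table, Table.lookup, cavity]
  | succ n ih =>
    intro j i h t ht σ τ hσ hτ s
    rw [table_succ]
    rcases ht.lt_or_eq with ht | rfl
    -- Keys in the new block have length `2 * (n + 1) + 1`, so shorter keys fall through to the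
    -- older table.
    · rw [Table.lookup_append_of_ne]
      · exact ih h (by omega) hσ hτ s
      · intro e he heq
        obtain ⟨s', σ', τ', h1, h2, rfl⟩ := mem_entries.1 he
        have := congrArg List.length heq
        simp at this
        omega
    · refine Table.lookup_append_of_forall _ ?_ ?_
      · intro e he heq
        obtain ⟨s', σ', τ', h1, h2, rfl⟩ := mem_entries.1 he
        simp only [List.cons.injEq] at heq
        obtain ⟨rfl, heq⟩ := heq
        -- The two halves of a key have equal length, so the concatenation determines them.
        obtain ⟨rfl, rfl⟩ := List.append_inj heq (by omega)
        exact entry_eq hM ih h _ h1 h2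
      · exact ⟨_, mem_entries.2 ⟨s, σ, τ, hσ, hτ, rfl⟩, rfl⟩

/-- The algorithm computes the Bayesian actions. -/
theorem tableActions_eq_traj (hM : M.graph.IsTree) (t : ℕ) (i : V) (x : V → Fin k) :
    M.tableActions t i (x i) (M.tables t i i) ((M.nbrs i).map fun j => M.traj t j x) =
      M.traj (t + 1) i x := by
  rw [tableActions_eq hM (tablesCorrect hM t) le_rfl, traj_succ, ← traj_eq_responses]
  · simp only [List.mem_map]
    rintro _ ⟨l, _, rfl⟩
    exact M.length_traj t l x
  · simp

/-- At time `0` no tables are needed. -/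
theorem tableActions_zero_nil (hM : M.graph.IsTree) (i : V) (x : V → Fin k) :
    M.tableActions 0 i (x i) [] ((M.nbrs i).map fun j => M.traj 0 j x) = M.traj 1 i x := by
  rw [← tableActions_eq_traj hM 0 i x, tableActions, tableActions, tableAction, tableAction]
  congr 3
  funext s
  rw [weight, weight]
  congr 1
  rw [likelihood_eq_one (TL := M.tables 0 i i)]
  · simp [likelihood]
  · simp [tables, table]

end Model

end SocialLearning

namespace SocialLearning

/-! ## Cost bounded evaluation -/

/-- Tuples as data. -/
def Val.tuple {V : Type*} (l : List (Val V)) : Val V := Val.ofList id l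

namespace Code

/-- A tuple of expressions. -/
def tuple : List Code → Code
  | [] => .nil
  | e :: l => .cons e (tuple l)

/-- The tuple without its first `n` entries. -/
def drop : ℕ → Code → Code
  | 0, e => e
  | n + 1, e => .tail (drop n e)

/-- The entry number `n` of a tuple. -/
def nth (n : ℕ) (e : Code) : Code := .head (drop n e)

/-- The list without its first entry, and the empty list if there is none. -/
def safeTail (e : Code) : Code := .ifNil e .nil (.tail e)

/-- The value of an expression that only rearranges data. -/
def value {V : Type*} (env : List (Val V)) : Code → Option (Val V)
  | .var n => env[n]?
  | .lit n => some (.num n)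
  | .nil => some .nil
  | .cons e₁ e₂ =>
    match value env e₁, value env e₂ with
    | some v, some w => some (.cons v w)
    | _, _ => none
  | .head e =>
    match value env e with
    | some (.cons v _) => some v
    | _ => none
  | .tail e =>
    match value env e with
    | some (.cons _ w) => some w
    | _ => none
  | _ => none

/-- The number of operations in an expression that only rearranges data. -/
def size : Code → ℕ
  | .cons e₁ e₂ => size e₁ + size e₂ + 1
  | .head e => size e + 1
  | .tail e => size e + 1
  | _ => 1

end Code

variable {V : Type*} {m k : ℕ} {M : Model V m k} {P : Program} {env : List (Val V)}
  {e e₁ e₂ e₃ e₄ : Code} {v w v₁ v₂ : Val V} {c c₁ c₂ c₃ : ℕ}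

/-- The expression `e` evaluates to `v` with at most `c` operations. -/
def Runs (M : Model V m k) (P : Program) (env : List (Val V)) (e : Code) (v : Val V) (c : ℕ) :
    Prop :=
  ∃ c' ≤ c, Eval M P env e v c'

/-- The function number `f` maps `v` to `w` with at most `c` operations. -/
def FnRuns (M : Model V m k) (P : Program) (f : ℕ) (v w : Val V) (c : ℕ) : Prop :=
  ∃ b, P[f]? = some b ∧ Runs M P [v] b w c

/-- Lets a single `rfl` settle both the value and the exact cost of code that only moves data. -/
theorem Eval.of_value (h : e.value env = some v) : Eval M P env e v e.size := by
  induction e generalizing v with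
  | var n => exact .var h
  | lit n => cases h; exact .lit n
  | nil => cases h; exact .nil
  | cons e₁ e₂ ih₁ ih₂ =>
    rw [Code.value] at h
    split at h
    · rename_i h₁ h₂
      cases h
      exact .cons (ih₁ h₁) (ih₂ h₂)
    · cases h
  | head e ih =>
    rw [Code.value] at h
    split at h
    · rename_i h₁
      cases h
      exact .head (ih h₁)
    · cases h
  | tail e ih =>
    rw [Code.value] at h
    split at h
    · rename_i h₁
      cases h
      exact .tail (ih h₁)
    · cases h
  | _ => cases h

namespace Runs

theorem of_value (h : e.value env = some v) : Runs M P env e v e.size :=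
  ⟨_, le_rfl, Eval.of_value h⟩

theorem mono (h : Runs M P env e v c₁) (hc : c₁ ≤ c₂) : Runs M P env e v c₂ := by
  obtain ⟨c, h1, h2⟩ := h
  exact ⟨c, h1.trans hc, h2⟩

theorem cons (h₁ : Runs M P env e₁ v₁ c₁) (h₂ : Runs M P env e₂ v₂ c₂) :
    Runs M P env (.cons e₁ e₂) (.cons v₁ v₂) (c₁ + c₂ + 1) := by
  obtain ⟨a, ha, h₁⟩ := h₁
  obtain ⟨b, hb, h₂⟩ := h₂
  exact ⟨_, by omega, h₁.cons h₂⟩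

theorem head (h : Runs M P env e (.cons v w) c) : Runs M P env (.head e) v (c + 1) := by
  obtain ⟨a, ha, h⟩ := h
  exact ⟨_, by omega, h.head⟩

theorem tail (h : Runs M P env e (.cons v w) c) : Runs M P env (.tail e) w (c + 1) := by
  obtain ⟨a, ha, h⟩ := h
  exact ⟨_, by omega, h.tail⟩

theorem add {a b : ℝ} (h₁ : Runs M P env e₁ (.num a) c₁) (h₂ : Runs M P env e₂ (.num b) c₂) :
    Runs M P env (.add e₁ e₂) (.num (a + b)) (c₁ + c₂ + 1) := by
  obtain ⟨a, ha, h₁⟩ := h₁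
  obtain ⟨b, hb, h₂⟩ := h₂
  exact ⟨_, by omega, h₁.add h₂⟩

theorem sub {a b : ℝ} (h₁ : Runs M P env e₁ (.num a) c₁) (h₂ : Runs M P env e₂ (.num b) c₂) :
    Runs M P env (.sub e₁ e₂) (.num (a - b)) (c₁ + c₂ + 1) := by
  obtain ⟨a, ha, h₁⟩ := h₁
  obtain ⟨b, hb, h₂⟩ := h₂
  exact ⟨_, by omega, h₁.sub h₂⟩

theorem mul {a b : ℝ} (h₁ : Runs M P env e₁ (.num a) c₁) (h₂ : Runs M P env e₂ (.num b) c₂) :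
    Runs M P env (.mul e₁ e₂) (.num (a * b)) (c₁ + c₂ + 1) := by
  obtain ⟨a, ha, h₁⟩ := h₁
  obtain ⟨b, hb, h₂⟩ := h₂
  exact ⟨_, by omega, h₁.mul h₂⟩

theorem pred {n : ℕ} (h : Runs M P env e (.num ((n + 1 : ℕ) : ℝ)) c) :
    Runs M P env (.sub e (.lit 1)) (.num (n : ℝ)) (c + 2) := by
  have := h.sub (Runs.of_value (e := .lit 1) rfl)
  simpa [Code.size, add_assoc] using this

theorem bind (h₁ : Runs M P env e₁ v₁ c₁) (h₂ : Runs M P (v₁ :: env) e₂ v₂ c₂) :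
    Runs M P env (.bind e₁ e₂) v₂ (c₁ + c₂ + 1) := by
  obtain ⟨a, ha, h₁⟩ := h₁
  obtain ⟨b, hb, h₂⟩ := h₂
  exact ⟨_, by omega, h₁.bind h₂⟩

theorem ifNil_nil (h : Runs M P env e .nil c) (h₁ : Runs M P env e₁ v c₁) :
    Runs M P env (.ifNil e e₁ e₂) v (c + c₁ + 1) := by
  obtain ⟨a, ha, h⟩ := h
  obtain ⟨b, hb, h₁⟩ := h₁
  exact ⟨_, by omega, .ifNil_nil h h₁⟩

theorem ifNil_cons (h : Runs M P env e (.cons v₁ v₂) c) (h₂ : Runs M P env e₂ v c₂) :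
    Runs M P env (.ifNil e e₁ e₂) v (c + c₂ + 1) := by
  obtain ⟨a, ha, h⟩ := h
  obtain ⟨b, hb, h₂⟩ := h₂
  exact ⟨_, by omega, .ifNil_cons h h₂⟩

theorem ifLe_true {a b : ℝ} (h₁ : Runs M P env e₁ (.num a) c₁) (h₂ : Runs M P env e₂ (.num b) c₂)
    (hab : a ≤ b) (h₃ : Runs M P env e₃ v c₃) :
    Runs M P env (.ifLe e₁ e₂ e₃ e₄) v (c₁ + c₂ + c₃ + 1) := by
  obtain ⟨_, _, h₁⟩ := h₁
  obtain ⟨_, _, h₂⟩ := h₂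
  obtain ⟨_, _, h₃⟩ := h₃
  exact ⟨_, by omega, .ifLe_true h₁ h₂ hab h₃⟩

theorem ifLe_false {a b : ℝ} (h₁ : Runs M P env e₁ (.num a) c₁) (h₂ : Runs M P env e₂ (.num b) c₂)
    (hab : ¬ a ≤ b) (h₃ : Runs M P env e₄ v c₃) :
    Runs M P env (.ifLe e₁ e₂ e₃ e₄) v (c₁ + c₂ + c₃ + 1) := by
  obtain ⟨_, _, h₁⟩ := h₁
  obtain ⟨_, _, h₂⟩ := h₂
  obtain ⟨_, _, h₃⟩ := h₃
  exact ⟨_, by omega, .ifLe_false h₁ h₂ hab h₃⟩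

theorem ifZero {a : ℝ} (h : Runs M P env e (.num a) c) (ha : a = 0)
    (h₃ : Runs M P env e₃ v c₃) : Runs M P env (.ifLe e (.lit 0) e₃ e₄) v (c + c₃ + 2) :=
  (ifLe_true h (Runs.of_value (e := .lit 0) rfl) (by simp [ha]) h₃).mono
    (by simp only [Code.size]; omega)

theorem ifSucc {n : ℕ} (h : Runs M P env e (.num ((n + 1 : ℕ) : ℝ)) c)
    (h₃ : Runs M P env e₄ v c₃) : Runs M P env (.ifLe e (.lit 0) e₃ e₄) v (c + c₃ + 2) :=
  (ifLe_false h (Runs.of_value (e := .lit 0) rfl)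
    (by push_cast; have : (0 : ℝ) ≤ n := n.cast_nonneg; linarith) h₃).mono
    (by simp only [Code.size]; omega)

theorem ifEq_true {i j : V} (h₁ : Runs M P env e₁ (.vtx i) c₁) (h₂ : Runs M P env e₂ (.vtx j) c₂)
    (hij : i = j) (h₃ : Runs M P env e₃ v c₃) :
    Runs M P env (.ifEq e₁ e₂ e₃ e₄) v (c₁ + c₂ + c₃ + 1) := by
  obtain ⟨_, _, h₁⟩ := h₁
  obtain ⟨_, _, h₂⟩ := h₂
  obtain ⟨_, _, h₃⟩ := h₃
  exact ⟨_, by omega, .ifEq_true h₁ h₂ hij h₃⟩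

theorem ifEq_false {i j : V} (h₁ : Runs M P env e₁ (.vtx i) c₁) (h₂ : Runs M P env e₂ (.vtx j) c₂)
    (hij : i ≠ j) (h₃ : Runs M P env e₄ v c₃) :
    Runs M P env (.ifEq e₁ e₂ e₃ e₄) v (c₁ + c₂ + c₃ + 1) := by
  obtain ⟨_, _, h₁⟩ := h₁
  obtain ⟨_, _, h₂⟩ := h₂
  obtain ⟨_, _, h₃⟩ := h₃
  exact ⟨_, by omega, .ifEq_false h₁ h₂ hij h₃⟩

theorem nbrs {i : V} (h : Runs M P env e (.vtx i) c) :
    Runs M P env (.nbrs e) (Val.ofList .vtx (M.nbrs i)) (c + 1) := by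
  obtain ⟨a, ha, h⟩ := h
  exact ⟨_, by omega, h.nbrs⟩

theorem prior : Runs M P env .prior (Val.ofPMF M.prior) 1 := ⟨1, le_rfl, .prior⟩

theorem signal {i : V} (h : Runs M P env e (.vtx i) c) : Runs M P env (.signal e)
    (Val.ofList (fun s => Val.ofPMF (M.signal i s)) (List.finRange m)) (c + 1) := by
  obtain ⟨a, ha, h⟩ := h
  exact ⟨_, by omega, h.signal⟩

theorem tie {i : V} {t : ℕ} {a : Fin k} {o : List (List (Fin m))} {A : Finset (Fin m)}
    (h : Runs M P env e (Val.view i t a o (Val.ofFinset A)) c) :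
    Runs M P env (.tie e) (Val.ofFin (M.tie i t a o A)) (c + 1) := by
  obtain ⟨a, ha, h⟩ := h
  exact ⟨_, by omega, h.tie⟩

theorem call {f : ℕ} (hf : FnRuns M P f v w c₂) (h : Runs M P env e v c₁) :
    Runs M P env (.call f e) w (c₁ + c₂ + 1) := by
  obtain ⟨b, hb, c', hc', hf⟩ := hf
  obtain ⟨a, ha, h⟩ := h
  exact ⟨_, by omega, .call hb h hf⟩

theorem safeTail {α : Type*} {f : α → Val V} {l : List α} (h : Runs M P env e (Val.ofList f l) c) :
    Runs M P env (Code.safeTail e) (Val.ofList f l.tail) (2 * c + 2) := by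
  cases l with
  | nil => exact (ifNil_nil h (of_value (e := .nil) rfl)).mono (by simp only [Code.size]; omega)
  | cons a l => exact (ifNil_cons h h.tail).mono (by omega)

end Runs

theorem FnRuns.mono {f : ℕ} (h : FnRuns M P f v w c₁) (hc : c₁ ≤ c₂) : FnRuns M P f v w c₂ := by
  obtain ⟨b, hb, h⟩ := h
  exact ⟨b, hb, h.mono hc⟩

/-! ### Iteration over a list -/

/-- The body of the function number `f` that maps a context, an initial value and a list to the
iteration of `step` over the list from the right. In the environment of `step` the variables are
the value so far, the current entry of the list and the context. -/
def foldBody (f : ℕ) (step : Code) : Code :=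
  .ifNil (.nth 2 (.var 0)) (.nth 1 (.var 0))
    (.bind (.nth 0 (.var 0))
      (.bind (.head (.nth 2 (.var 1)))
        (.bind (.call f (.tuple [.var 1, .nth 1 (.var 2), .tail (.nth 2 (.var 2))])) step)))

/-- The step is analyzed only on values that really arise, namely folds of suffixes of the list.
This is needed when its cost depends on the size of the accumulated value. The constant `40` pays
for taking the argument apart and for the recursive call. -/
theorem FnRuns.fold_suffix {f : ℕ} {step : Code} (hf : P[f]? = some (foldBody f step))
    {α β : Type*} {encα : α → Val V} {encβ : β → Val V} {g : α → β → β} {ctx : Val V} {b : β}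
    {l : List α} (B : ℕ)
    (h : ∀ a l', a :: l' <:+ l → ∀ arg, Runs M P
      [encβ (l'.foldr g b), encα a, ctx, arg] step (encβ (g a (l'.foldr g b))) B) :
    FnRuns M P f (Val.tuple [ctx, encβ b, Val.ofList encα l]) (encβ (l.foldr g b))
      ((B + 40) * (l.length + 1)) := by
  refine ⟨_, hf, ?_⟩
  induction l with
  | nil =>
    refine Runs.mono (Runs.ifNil_nil (Runs.of_value rfl) (Runs.of_value rfl)) ?_
    simp only [Code.size, Code.nth, Code.drop, List.length_nil]
    omega
  | cons a l ih =>
    refine Runs.mono (Runs.ifNil_cons (Runs.of_value rfl) (Runs.bind (Runs.of_value rfl)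
      (Runs.bind (Runs.of_value rfl) (Runs.bind (Runs.call ⟨_, hf, ih fun a' l' h' =>
        h a' l' (h'.trans (List.suffix_cons a l))⟩ (Runs.of_value rfl))
          (h a l List.suffix_rfl _))))) ?_
    simp only [Code.size, Code.nth, Code.drop, Code.tuple, List.length_cons]
    ring_nf
    omega

theorem FnRuns.fold {f : ℕ} {step : Code} (hf : P[f]? = some (foldBody f step))
    {α β : Type*} {encα : α → Val V} {encβ : β → Val V} {g : α → β → β} {ctx : Val V} {b : β}
    {l : List α} (B : ℕ)
    (h : ∀ a ∈ l, ∀ b arg, Runs M P [encβ b, encα a, ctx, arg] step (encβ (g a b)) B) :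
    FnRuns M P f (Val.tuple [ctx, encβ b, Val.ofList encα l]) (encβ (l.foldr g b))
      ((B + 40) * (l.length + 1)) :=
  FnRuns.fold_suffix hf B fun a _ hl => h a (hl.mem (List.mem_cons_self ..)) _

/-! ## The program -/

namespace Program

open Code

abbrev fRun : ℕ := 1
abbrev fMapTail : ℕ := 2
abbrev fAction : ℕ := 3
abbrev fWeights : ℕ := 4
abbrev fMax : ℕ := 5
abbrev fBest : ℕ := 6
abbrev fIota : ℕ := 7
abbrev fNth : ℕ := 8
abbrev fLikelihood : ℕ := 9
abbrev fLookup : ℕ := 10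
abbrev fEq : ℕ := 11
abbrev fAppend : ℕ := 12
abbrev fConsEach : ℕ := 13
abbrev fProd : ℕ := 14
abbrev fSequences : ℕ := 15
abbrev fViews : ℕ := 16
abbrev fSumViews : ℕ := 17
abbrev fSumSignals : ℕ := 18
abbrev fEntries₃ : ℕ := 19
abbrev fEntries₂ : ℕ := 20
abbrev fEntries₁ : ℕ := 21
abbrev fTable : ℕ := 22
abbrev fTables : ℕ := 23
abbrev fTablesFold : ℕ := 24

/-- The list of the states. -/
def states : Code := .call fIota (tuple [.lit 0, .prior])

/-- The list of the signals, computed from the signal probabilities of the agent `j`. -/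
def signals (j : Code) : Code := .call fIota (tuple [.lit 0, .head (.signal j)])

/-- The datum that stands for a failed comparison. -/
def distinct : Code := .cons .nil .nil

/-- Input: the agent, the time, her signal and the past actions of her neighbors. -/
def main : Code :=
  .call fRun (tuple [nth 0 (.var 0), nth 1 (.var 0), nth 2 (.var 0),
    .ifLe (nth 1 (.var 0)) (.lit 0) .nil
      (.call fTables (tuple [nth 0 (.var 0), nth 0 (.var 0), nth 1 (.var 0)])), nth 3 (.var 0)])

/-- Input: agent, time, signal, tables of the neighbors, past actions of the neighbors. -/
def run : Code :=
  .bind (.ifLe (nth 1 (.var 0)) (.lit 0) .nil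
    (.call fRun (tuple [nth 0 (.var 0), .sub (nth 1 (.var 0)) (.lit 1), nth 2 (.var 0),
      nth 3 (.var 0), .call fMapTail (tuple [.nil, .nil, nth 4 (.var 0)])])))
    (.cons (.call fAction (.cons (.var 0) (.var 1))) (.var 0))

/-- Input: own past actions, followed by the input of `run`. -/
def action : Code :=
  .bind (.call fWeights (tuple [.var 0, .nil, states]))
    (.bind (.call fBest (tuple [.call fMax (tuple [.nil, .lit 0, .var 0]), .nil, .var 0]))
      (.tie (.cons (nth 1 (.var 2)) (.cons (nth 2 (.var 2)) (.cons (nth 3 (.var 2))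
        (.cons (nth 5 (.var 2)) (.var 0)))))))

/-- The probability of the signal `a` of agent `j` in the state `s`. -/
def signalProb (j s a : Code) : Code :=
  .call fNth (.cons (.call fNth (.cons (.signal j) s)) a)

/-- Step of the list of the weights of the states. -/
def weights : Code :=
  .cons (.cons (.var 1) (.mul
    (.call fLikelihood (tuple [.var 1, nth 0 (.var 2), nth 4 (.var 2), nth 5 (.var 2)]))
    (.mul (.call fNth (.cons .prior (.var 1)))
      (signalProb (nth 1 (.var 2)) (.var 1) (nth 3 (.var 2)))))) (.var 0)

/-- Input: a number and a list, whose entries are replaced by consecutive numbers. -/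
def iota : Code :=
  .ifNil (nth 1 (.var 0)) .nil (.cons (nth 0 (.var 0))
    (.call fIota (tuple [.add (nth 0 (.var 0)) (.lit 1), .tail (nth 1 (.var 0))])))

/-- Input: a list and a position. -/
def nthEntry : Code :=
  .ifLe (.tail (.var 0)) (.lit 0) (.head (.head (.var 0)))
    (.call fNth (.cons (.tail (.head (.var 0))) (.sub (.tail (.var 0)) (.lit 1))))

/-- Input: state, own actions, tables and actions of the neighbors. -/
def likelihood : Code :=
  .ifNil (nth 2 (.var 0)) (.lit 1) (.ifNil (nth 3 (.var 0)) (.lit 1)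
    (.mul (.call fLookup (tuple [.cons (nth 0 (.var 0))
      (.call fAppend (tuple [.nil, nth 1 (.var 0), .head (nth 3 (.var 0))])), .lit 1,
        .head (nth 2 (.var 0))]))
      (.call fLikelihood (tuple [nth 0 (.var 0), nth 1 (.var 0), .tail (nth 2 (.var 0)),
        .tail (nth 3 (.var 0))]))))

/-- Input: two lists of numbers. -/
def eq : Code :=
  .ifNil (.head (.var 0)) (.ifNil (.tail (.var 0)) .nil distinct)
    (.ifNil (.tail (.var 0)) distinct
      (.ifLe (.head (.head (.var 0))) (.head (.tail (.var 0)))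
        (.ifLe (.head (.tail (.var 0))) (.head (.head (.var 0)))
          (.call fEq (.cons (.tail (.head (.var 0))) (.tail (.tail (.var 0))))) distinct) distinct))

/-- Input: a number. -/
def sequences : Code :=
  .ifLe (.var 0) (.lit 0) (.cons .nil .nil)
    (.call fProd (tuple [states, .nil, .call fSequences (.sub (.var 0) (.lit 1))]))

/-- Step of the list of the past actions of the neighbors; the context consists of an agent, her
actions, and the list of all sequences of actions. -/
def views : Code :=
  .call fProd (tuple [.ifEq (.var 1) (nth 0 (.var 2)) (.cons (nth 1 (.var 2)) .nil)
    (nth 2 (.var 2)), .nil, .var 0])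

/-- Step of the sum over the past actions of the neighbors; the context consists of the agent, the
time, the signal, the tables, her actions, the state, and the tables without the excepted one. -/
def sumViews : Code :=
  .ifNil (.call fEq (.cons (.call fRun (tuple [nth 0 (.var 2), nth 1 (.var 2), nth 2 (.var 2),
      nth 3 (.var 2), .var 1])) (nth 4 (.var 2))))
    (.add (.mul (signalProb (nth 0 (.var 2)) (nth 5 (.var 2)) (nth 2 (.var 2)))
      (.call fLikelihood (tuple [nth 5 (.var 2), safeTail (nth 4 (.var 2)), nth 6 (.var 2),
        .var 1]))) (.var 0)) (.var 0)

/-- Step of the sum over the signals; the context consists of the agent, the time, the tables, her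
actions, the state, the tables without the excepted one, and the list of the past actions of the
neighbors. -/
def sumSignals : Code :=
  .call fSumViews (tuple [tuple [nth 0 (.var 2), nth 1 (.var 2), .var 1, nth 2 (.var 2),
    nth 3 (.var 2), nth 4 (.var 2), nth 5 (.var 2)], .var 0, nth 6 (.var 2)])

/-- Innermost step of the list of the entries of a table; the context consists of the actions, the
state, the agent, the excepted neighbor, the time, the two lists of tables, and the lists of all
sequences of actions up to now and up to the next time. -/
def entries₃ : Code :=
  .cons (.cons (.cons (nth 1 (.var 2)) (.call fAppend (tuple [.nil, .var 1, nth 0 (.var 2)])))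
    (.call fSumSignals (tuple [tuple [nth 2 (.var 2), nth 4 (.var 2), nth 5 (.var 2),
      nth 0 (.var 2), nth 1 (.var 2), nth 6 (.var 2),
      .call fViews (tuple [tuple [nth 3 (.var 2), safeTail (.var 1), nth 7 (.var 2)],
        .cons .nil .nil, .nbrs (nth 2 (.var 2))])], .lit 0, signals (nth 2 (.var 2))]))) (.var 0)

/-- Second step of the list of the entries of a table. -/
def entries₂ : Code :=
  .call fEntries₃ (tuple [.cons (.var 1) (.var 2), .var 0, nth 7 (.var 2)])

/-- First step of the list of the entries of a table. -/
def entries₁ : Code :=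
  .call fEntries₂ (tuple [.cons (.var 1) (.var 2), .var 0, nth 6 (.var 2)])

/-- Input: an agent, the excepted neighbor, and the number of actions. -/
def table : Code :=
  .ifLe (nth 2 (.var 0)) (.lit 0) .nil
    (.bind (.sub (nth 2 (.var 0)) (.lit 1))
      (.call fEntries₁ (tuple [tuple [nth 0 (.var 1), nth 1 (.var 1), .var 0,
        .call fTables (tuple [nth 0 (.var 1), nth 0 (.var 1), .var 0]),
        .call fTables (tuple [nth 0 (.var 1), nth 1 (.var 1), .var 0]),
        .call fSequences (.var 0), .call fSequences (nth 2 (.var 1))],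
        .call fTable (tuple [nth 0 (.var 1), nth 1 (.var 1), .var 0]), states])))

/-- Input: an agent, the excepted neighbor, and the number of actions. -/
def tables : Code :=
  .call fTablesFold (tuple [.var 0, .nil, .nbrs (nth 0 (.var 0))])

/-- Step of the list of the tables of the neighbors; the context is the input of `tables`. -/
def tablesFold : Code :=
  .cons (.ifEq (.var 1) (nth 1 (.var 2)) .nil
    (.call fTable (tuple [.var 1, nth 0 (.var 2), nth 2 (.var 2)]))) (.var 0)

/-- The dynamic cavity algorithm. -/
def dynamicCavity : Program :=
  [main, run,
    foldBody fMapTail (.cons (safeTail (.var 1)) (.var 0)),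
    action,
    foldBody fWeights weights,
    foldBody fMax (.ifLe (.var 0) (.tail (.var 1)) (.tail (.var 1)) (.var 0)),
    foldBody fBest (.ifLe (.var 2) (.tail (.var 1)) (.cons (.head (.var 1)) (.var 0)) (.var 0)),
    iota, nthEntry, likelihood,
    foldBody fLookup (.ifNil (.call fEq (.cons (.head (.var 1)) (.var 2))) (.tail (.var 1))
      (.var 0)),
    eq,
    foldBody fAppend (.cons (.var 1) (.var 0)),
    foldBody fConsEach (.cons (.cons (.var 1) (.var 2)) (.var 0)),
    foldBody fProd (.call fConsEach (tuple [.var 1, .var 0, .var 2])),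
    sequences,
    foldBody fViews views,
    foldBody fSumViews sumViews,
    foldBody fSumSignals sumSignals,
    foldBody fEntries₃ entries₃,
    foldBody fEntries₂ entries₂,
    foldBody fEntries₁ entries₁,
    table, tables,
    foldBody fTablesFold tablesFold]

end Program

end SocialLearning

namespace SocialLearning

open Program

/-! ## Running times -/

variable {V : Type*} {m k : ℕ} {M : Model V m k} {L : ℕ}

/-- A sequence of actions as a datum. -/
abbrev Val.ofSeq (l : List (Fin m)) : Val V := Val.ofList Val.ofFin l

/-- The past actions of the neighbors as a datum. -/
abbrev Val.ofSeqs (o : List (List (Fin m))) : Val V := Val.ofList Val.ofSeq o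

/-- An entry of a table as a datum. -/
abbrev Val.ofEntry (e : List (Fin m) × ℝ) : Val V := .cons (Val.ofSeq e.1) (.num e.2)

/-- A table as a datum. -/
abbrev Val.ofTable (T : Table m) : Val V := Val.ofList Val.ofEntry T

theorem hundred_mul_pow_le (hL : 100 ≤ L) (p : ℕ) : 100 * L ^ p ≤ L ^ (p + 1) := by
  rw [pow_succ']
  exact Nat.mul_le_mul_right _ hL

/-- The accounting rule of all loops: if every list is shorter than `L`, a loop raises the exponent
of `L` by two, one for the constants and one for the number of iterations. -/
theorem mul_succ_le_pow (hL : 100 ≤ L) {B c n p : ℕ} (hB : B + c ≤ 100 * L ^ p) (hn : n + 1 ≤ L) :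
    (B + c) * (n + 1) ≤ L ^ (p + 2) := by
  rw [pow_succ]
  exact Nat.mul_le_mul (hB.trans (hundred_mul_pow_le hL p)) hn

theorem runs_append (hL : 100 ≤ L) (l l' : List (Fin m)) (hl : l.length + 1 ≤ L) :
    FnRuns M dynamicCavity fAppend (Val.tuple [.nil, Val.ofSeq l', Val.ofSeq l])
      (Val.ofSeq (l ++ l')) (L ^ 2) := by
  have h := FnRuns.fold (M := M) (P := dynamicCavity) (f := fAppend) rfl (encα := Val.ofFin)
    (encβ := Val.ofSeq) (g := fun a (b : List (Fin m)) => a :: b) (ctx := .nil) (b := l') (l := l) 3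
    fun a _ b arg => Runs.of_value rfl
  rw [List.foldr_cons_eq_append'] at h
  exact h.mono (mul_succ_le_pow (p := 0) hL (by simp) hl)

theorem runs_mapTail (hL : 100 ≤ L) (o : List (List (Fin m))) (ho : o.length + 1 ≤ L) :
    FnRuns M dynamicCavity fMapTail (Val.tuple [.nil, .nil, Val.ofSeqs o])
      (Val.ofSeqs (o.map List.tail)) (L ^ 2) := by
  have h := FnRuns.fold (M := M) (P := dynamicCavity) (f := fMapTail) rfl (encα := Val.ofSeq)
    (encβ := Val.ofSeqs) (g := fun a (b : List (List (Fin m))) => a.tail :: b) (ctx := .nil)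
    (b := []) (l := o) 6
    fun a _ b arg => Runs.cons (Runs.safeTail (Runs.of_value rfl)) (Runs.of_value rfl)
  rw [← List.map_eq_foldr] at h
  exact h.mono (mul_succ_le_pow (p := 0) hL (by simp) ho)

theorem runs_max (hL : 100 ≤ L) (l : List (Fin m × ℝ)) (hl : l.length + 1 ≤ L) :
    FnRuns M dynamicCavity fMax (Val.tuple [.nil, .num (0 : ℕ),
      Val.ofList (fun e => .cons (Val.ofFin e.1) (.num e.2)) l])
      (.num ((l.map Prod.snd).foldr max 0)) (L ^ 2) := by
  have h := FnRuns.fold (M := M) (P := dynamicCavity) (f := fMax) rfl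
    (encα := fun e : Fin m × ℝ => .cons (Val.ofFin e.1) (.num e.2))
    (encβ := .num) (g := fun e b => max e.2 b) (ctx := .nil) (b := (0 : ℕ)) (l := l) 10
    fun a _ b arg => by
      by_cases hb : b ≤ a.2
      · rw [max_eq_left hb]
        exact (Runs.ifLe_true (Runs.of_value rfl) (Runs.of_value rfl) hb (Runs.of_value rfl)).mono
          (by simp [Code.size])
      · rw [max_eq_right (le_of_not_ge hb)]
        exact (Runs.ifLe_false (Runs.of_value rfl) (Runs.of_value rfl) hb (Runs.of_value rfl)).mono
          (by simp [Code.size])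
  rw [List.foldr_map]
  convert h.mono (mul_succ_le_pow (p := 0) hL (by simp) hl) using 2
  simp

open Classical in
theorem runs_best (hL : 100 ≤ L) (c : ℝ) (l : List (Fin m × ℝ)) (hl : l.length + 1 ≤ L) :
    FnRuns M dynamicCavity fBest (Val.tuple [.num c, .nil,
      Val.ofList (fun e => .cons (Val.ofFin e.1) (.num e.2)) l])
      (Val.ofSeq ((l.filter fun e => c ≤ e.2).map Prod.fst)) (L ^ 2) := by
  have h2 : (l.filter fun e => c ≤ e.2).map Prod.fst =
      l.foldr (fun e b => if c ≤ e.2 then e.1 :: b else b) [] := by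
    clear hl
    induction l with
    | nil => rfl
    | cons e l ih =>
      rw [List.foldr_cons, ← ih, List.filter_cons]
      by_cases he : c ≤ e.2 <;> simp [he]
  have h := FnRuns.fold (M := M) (P := dynamicCavity) (f := fBest) rfl
    (encα := fun e : Fin m × ℝ => .cons (Val.ofFin e.1) (.num e.2))
    (encβ := Val.ofSeq) (g := fun e b => if c ≤ e.2 then e.1 :: b else b) (ctx := .num c) (b := [])
    (l := l) 10
    fun a _ b arg => by
      split_ifs with hb
      · exact (Runs.ifLe_true (Runs.of_value rfl) (Runs.of_value rfl) hb (Runs.of_value rfl)).mono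
          (by simp [Code.size])
      · exact (Runs.ifLe_false (Runs.of_value rfl) (Runs.of_value rfl) hb (Runs.of_value rfl)).mono
          (by simp [Code.size])
  rw [h2]
  exact h.mono (mul_succ_le_pow (p := 0) hL (by simp) hl)

theorem runs_consEach (hL : 100 ≤ L) {α : Type*} (enc : α → Val V) (A : List α) (l : List α)
    (acc : List (List α)) (hA : A.length + 1 ≤ L) :
    FnRuns M dynamicCavity fConsEach (Val.tuple [Val.ofList enc l,
      Val.ofList (Val.ofList enc) acc, Val.ofList enc A])
      (Val.ofList (Val.ofList enc) (A.map (fun a => a :: l) ++ acc)) (L ^ 2) := by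
  have h := FnRuns.fold (M := M) (P := dynamicCavity) (f := fConsEach) rfl
    (encα := enc) (encβ := Val.ofList (Val.ofList enc)) (g := fun a b => (a :: l) :: b)
    (ctx := Val.ofList enc l) (b := acc) (l := A) 5
    fun a _ b arg => Runs.of_value rfl
  have h2 : A.map (fun a => a :: l) ++ acc = A.foldr (fun a b => (a :: l) :: b) acc := by
    clear h hA
    induction A with
    | nil => rfl
    | cons a A ih => rw [List.foldr_cons, ← ih]; rfl
  rw [h2]
  exact h.mono (mul_succ_le_pow (p := 0) hL (by simp) hA)

theorem runs_prod (hL : 100 ≤ L) {α : Type*} (enc : α → Val V) (A : List α) (B : List (List α))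
    (hA : A.length + 1 ≤ L) (hB : B.length + 1 ≤ L) :
    FnRuns M dynamicCavity fProd (Val.tuple [Val.ofList enc A, .nil,
      Val.ofList (Val.ofList enc) B])
      (Val.ofList (Val.ofList enc) (B.flatMap fun l => A.map fun a => a :: l)) (L ^ 4) := by
  have h := FnRuns.fold (M := M) (P := dynamicCavity) (f := fProd) rfl
    (encα := Val.ofList enc) (encβ := Val.ofList (Val.ofList enc))
    (g := fun l acc => A.map (fun a => a :: l) ++ acc)
    (ctx := Val.ofList enc A) (b := []) (l := B) _
    fun l _ b arg => Runs.call (runs_consEach hL enc A l b hA) (Runs.of_value rfl)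
  have h2 : (B.flatMap fun l => A.map fun a => a :: l) =
      B.foldr (fun l acc => A.map (fun a => a :: l) ++ acc) [] := by
    clear h hB
    induction B with
    | nil => rfl
    | cons a A ih => rw [List.foldr_cons, ← ih]; rfl
  rw [h2]
  refine h.mono (mul_succ_le_pow (p := 2) hL ?_ hB)
  have := Nat.one_le_pow 2 L (by omega)
  simp only [Code.size, Code.tuple]
  omega

theorem Val.ofList_map {α β : Type*} (f : β → Val V) (g : α → β) (l : List α) :
    Val.ofList f (l.map g) = Val.ofList (fun a => f (g a)) l := by
  induction l with
  | nil => rfl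
  | cons a l ih => rw [List.map_cons, Val.ofList, ih]; rfl

theorem runs_iota_aux {α : Type*} (enc : α → Val V) (l : List α) (n : ℕ) :
    FnRuns M dynamicCavity fIota (Val.tuple [.num (n : ℝ), Val.ofList enc l])
      (Val.ofList (fun j : ℕ => .num (j : ℝ)) (List.range' n l.length)) (30 * (l.length + 1)) := by
  refine ⟨_, rfl, ?_⟩
  induction l generalizing n with
  | nil =>
    refine (Runs.ifNil_nil (Runs.of_value rfl) (Runs.of_value rfl)).mono ?_
    simp [Code.size, Code.nth, Code.drop]
  | cons a l ih =>
    specialize ih (n + 1)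
    push_cast at ih
    refine Runs.mono (Runs.ifNil_cons (Runs.of_value rfl) (Runs.cons (Runs.of_value rfl)
      (Runs.call ⟨_, rfl, ih⟩ (Runs.cons (Runs.add (Runs.of_value rfl)
        ((Runs.of_value (v := .num 1) (by simp [Code.value])))) (Runs.of_value rfl))))) ?_
    simp only [Code.size, Code.nth, Code.drop, Code.tuple, List.length_cons]
    omega

theorem runs_iota (hL : 100 ≤ L) {α : Type*} (enc : α → Val V) (l : List α) {n : ℕ}
    (hl : l.length = n) (hn : n + 1 ≤ L) :
    FnRuns M dynamicCavity fIota (Val.tuple [.num (0 : ℕ), Val.ofList enc l])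
      (Val.ofList Val.ofFin (List.finRange n)) (L ^ 2) := by
  have h := runs_iota_aux (M := M) enc l 0
  have h2 : List.range' 0 l.length = (List.finRange n).map (fun j : Fin n => (j : ℕ)) := by
    rw [hl, ← List.range_eq_range', List.map_coe_finRange_eq_range]
  rw [h2, Val.ofList_map] at h
  refine h.mono ?_
  rw [hl, pow_two]
  exact Nat.mul_le_mul (by omega) hn

/-- One program serves all `m`; it learns the number of states by counting the prior probabilities.
-/
theorem runs_states (hL : 100 ≤ L) (hm : m + 1 ≤ L) (env : List (Val V)) :
    Runs M dynamicCavity env states (Val.ofList Val.ofFin (List.finRange m)) (L ^ 2 + 6) := by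
  refine (Runs.call (runs_iota hL _ _ (List.length_finRange (n := m)) hm)
    (Runs.cons (Runs.of_value rfl) (Runs.cons Runs.prior (Runs.of_value rfl)))).mono ?_
  simp only [Code.size, Code.tuple]
  omega

theorem runs_signals (hL : 100 ≤ L) (hm : 0 < m) (hk : k + 1 ≤ L) {env : List (Val V)} {e : Code}
    {j : V} {c : ℕ} (h : Runs M dynamicCavity env e (.vtx j) c) :
    Runs M dynamicCavity env (signals e) (Val.ofList Val.ofFin (List.finRange k))
      (c + L ^ 2 + 8) := by
  -- The signals are counted in the first row of the signal table, which exists because `m` is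
  -- positive.
  obtain ⟨s, l, hl⟩ := List.exists_cons_of_ne_nil (l := List.finRange m) (by
    rw [← List.length_pos_iff]; simpa using hm)
  have h1 := h.signal
  rw [hl] at h1
  refine (Runs.call (runs_iota hL _ _ (List.length_finRange (n := k)) hk)
    (Runs.cons (Runs.of_value rfl) (Runs.cons h1.head (Runs.of_value rfl)))).mono ?_
  simp only [Code.size, Code.tuple]
  omega

theorem runs_nth_aux {α : Type*} (enc : α → Val V) (l : List α) (n : ℕ) (hn : n < l.length) :
    FnRuns M dynamicCavity fNth (.cons (Val.ofList enc l) (.num (n : ℝ))) (enc l[n])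
      (30 * (n + 1)) := by
  refine ⟨_, rfl, ?_⟩
  induction n generalizing l with
  | zero =>
    cases l with
    | nil => simp at hn
    | cons a l =>
      refine (Runs.ifZero (Runs.of_value rfl) (by simp) (Runs.of_value rfl)).mono ?_
      simp [Code.size]
  | succ n ih =>
    cases l with
    | nil => simp at hn
    | cons a l =>
      specialize ih l (by simpa using hn)
      refine (Runs.ifSucc (Runs.of_value rfl) (Runs.call ⟨_, rfl, ih⟩
        (Runs.cons (Runs.of_value rfl) (Runs.pred (Runs.of_value rfl))))).mono ?_
      simp only [Code.size]
      omega

theorem runs_nth (hL : 100 ≤ L) {n : ℕ} (hn : n + 1 ≤ L) (enc : Fin n → Val V) (a : Fin n) :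
    FnRuns M dynamicCavity fNth (.cons (Val.ofList enc (List.finRange n)) (Val.ofFin a)) (enc a)
      (L ^ 2) := by
  have h := runs_nth_aux (M := M) enc (List.finRange n) a (by simp)
  simp only [List.getElem_finRange, Fin.cast_mk, Fin.eta] at h
  refine h.mono ?_
  rw [pow_two]
  exact Nat.mul_le_mul (by omega) (by omega)

theorem runs_signalProb (hL : 100 ≤ L) (hm : m + 1 ≤ L) (hk : k + 1 ≤ L) {env : List (Val V)}
    {j : V} {s : Fin m} {a : Fin k} {e₁ e₂ e₃ : Code} {c₁ c₂ c₃ : ℕ}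
    (h₁ : Runs M dynamicCavity env e₁ (.vtx j) c₁)
    (h₂ : Runs M dynamicCavity env e₂ (Val.ofFin s) c₂)
    (h₃ : Runs M dynamicCavity env e₃ (Val.ofFin a) c₃) :
    Runs M dynamicCavity env (signalProb e₁ e₂ e₃) (.num (M.signal j s a).toReal)
      (2 * L ^ 2 + c₁ + c₂ + c₃ + 5) :=
  (Runs.call (runs_nth hL hk (fun a => .num (M.signal j s a).toReal) a)
    (Runs.cons (Runs.call (runs_nth hL hm (fun s => Val.ofPMF (M.signal j s)) s)
      (Runs.cons h₁.signal h₂)) h₃)).mono (by omega)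

theorem runs_eq (l l' : List (Fin m)) :
    FnRuns M dynamicCavity fEq (.cons (Val.ofSeq l) (Val.ofSeq l'))
      (if l = l' then .nil else .cons .nil .nil) (40 * (l.length + 1)) := by
  refine ⟨_, rfl, ?_⟩
  induction l generalizing l' with
  | nil =>
    cases l' with
    | nil =>
      rw [if_pos rfl]
      exact (Runs.ifNil_nil (Runs.of_value rfl) (Runs.ifNil_nil (Runs.of_value rfl)
        (Runs.of_value rfl))).mono (by simp [Code.size])
    | cons b l' =>
      rw [if_neg (by simp)]
      exact (Runs.ifNil_nil (Runs.of_value rfl) (Runs.ifNil_cons (Runs.of_value rfl)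
        (Runs.of_value rfl))).mono (by simp [Code.size, distinct])
  | cons a l ih =>
    cases l' with
    | nil =>
      rw [if_neg (by simp)]
      exact (Runs.ifNil_cons (Runs.of_value rfl) (Runs.ifNil_nil (Runs.of_value rfl)
        (Runs.of_value rfl))).mono (by simp [Code.size, distinct]; omega)
    | cons b l' =>
      specialize ih l'
      refine Runs.mono (Runs.ifNil_cons (Runs.of_value rfl) (Runs.ifNil_cons (c₂ :=
        40 * (l.length + 1) + 25) (Runs.of_value rfl) ?_))
        (by simp only [Code.size, List.length_cons]; omega)
      by_cases h1 : ((a : ℕ) : ℝ) ≤ ((b : ℕ) : ℝ)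
      · by_cases h2 : ((b : ℕ) : ℝ) ≤ ((a : ℕ) : ℝ)
        · have hab : a = b := by
            rw [Fin.ext_iff]
            exact_mod_cast le_antisymm h1 h2
          have h3 : (a :: l = b :: l') = (l = l') := by simp [hab]
          rw [if_congr (iff_of_eq h3) rfl rfl]
          exact (Runs.ifLe_true (Runs.of_value rfl) (Runs.of_value rfl) h1 (Runs.ifLe_true
            (Runs.of_value rfl) (Runs.of_value rfl) h2 (Runs.call ⟨_, rfl, ih⟩
              (Runs.of_value rfl)))).mono (by simp only [Code.size]; omega)
        · rw [if_neg (by rintro ⟨⟩; exact h2 le_rfl)]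
          exact (Runs.ifLe_true (Runs.of_value rfl) (Runs.of_value rfl) h1 (Runs.ifLe_false
            (Runs.of_value rfl) (Runs.of_value rfl) h2 (Runs.of_value rfl))).mono
              (by simp only [Code.size, distinct]; omega)
      · rw [if_neg (by rintro ⟨⟩; exact h1 le_rfl)]
        exact (Runs.ifLe_false (Runs.of_value rfl) (Runs.of_value rfl) h1
          (Runs.of_value rfl)).mono (by simp only [Code.size, distinct]; omega)

/-- A bound for the length of a table and of its keys. -/
def Table.Small (L : ℕ) (T : Table m) : Prop :=
  T.length + 1 ≤ L ∧ ∀ e ∈ T, e.1.length + 1 ≤ L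

theorem runs_lookup (hL : 100 ≤ L) {T : Table m} (hT : T.Small L) (key : List (Fin m)) :
    FnRuns M dynamicCavity fLookup (Val.tuple [Val.ofSeq key, .num (1 : ℕ), Val.ofTable T])
      (.num (T.lookup key)) (L ^ 4) := by
  have h := FnRuns.fold (M := M) (P := dynamicCavity) (f := fLookup) rfl
    (encα := Val.ofEntry) (encβ := .num) (g := fun e b => if e.1 = key then e.2 else b)
    (ctx := Val.ofSeq key) (b := (1 : ℕ)) (l := T) (L ^ 2 + 20)
    fun e he b arg => by
      have h1 := runs_eq (M := M) e.1 key
      have h2 : 40 * (e.1.length + 1) ≤ L ^ 2 := by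
        rw [pow_two]
        exact Nat.mul_le_mul (by omega) (hT.2 e he)
      split_ifs with hk
      · rw [if_pos hk] at h1
        exact (Runs.ifNil_nil (Runs.call h1 (Runs.of_value rfl)) (Runs.of_value rfl)).mono
          (by simp only [Code.size]; omega)
      · rw [if_neg hk] at h1
        exact (Runs.ifNil_cons (Runs.call h1 (Runs.of_value rfl)) (Runs.of_value rfl)).mono
          (by simp only [Code.size]; omega)
  have h3 : T.foldr (fun e b => if e.1 = key then e.2 else b) ((1 : ℕ) : ℝ) = T.lookup key := by
    rw [Nat.cast_one]; rfl
  rw [h3] at h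
  refine h.mono (mul_succ_le_pow (p := 2) hL ?_ hT.1)
  have := Nat.one_le_pow 2 L (by omega)
  omega

/-- The recursion stops as soon as the tables run out, so the number of observed neighbors does not
enter the cost. This matters at time `0`, when no tables are supplied. -/
theorem runs_likelihood (hL : 100 ≤ L) (s : Fin m) (r : List (Fin m)) {TL : List (Table m)}
    (hTL : TL.length + 1 ≤ L) (hT : ∀ T ∈ TL, T.Small L) {o : List (List (Fin m))}
    (ho : ∀ ρ ∈ o, ρ.length + 1 ≤ L) :
    FnRuns M dynamicCavity fLikelihood (Val.tuple [Val.ofFin s, Val.ofSeq r,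
      Val.ofList Val.ofTable TL, Val.ofSeqs o]) (.num (likelihood s r TL o)) (L ^ 6) := by
  have key : FnRuns M dynamicCavity fLikelihood (Val.tuple [Val.ofFin s, Val.ofSeq r,
      Val.ofList Val.ofTable TL, Val.ofSeqs o]) (.num (likelihood s r TL o))
      ((L ^ 4 + L ^ 2 + 100) * (TL.length + 1)) := by
    clear hTL
    refine ⟨_, rfl, ?_⟩
    induction TL generalizing o with
    | nil =>
      refine (Runs.ifNil_nil (Runs.of_value rfl)
        (Runs.of_value (v := .num 1) (by simp [Code.value]))).mono ?_
      simp only [Code.size, Code.nth, Code.drop, List.length_nil]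
      omega
    | cons T TL ih =>
      cases o with
      | nil =>
        refine (Runs.ifNil_cons (Runs.of_value rfl) (Runs.ifNil_nil (Runs.of_value rfl)
          (Runs.of_value (v := .num 1) (by simp [Code.value])))).mono ?_
        simp only [Code.size, Code.nth, Code.drop, List.length_cons]
        ring_nf
        omega
      | cons ρ o =>
        specialize ih (fun T hT' => hT T (by simp [hT'])) (o := o) fun ρ hρ => ho ρ (by simp [hρ])
        refine (Runs.ifNil_cons (Runs.of_value rfl) (Runs.ifNil_cons (Runs.of_value rfl)
          (Runs.mul (Runs.call (runs_lookup hL (hT T (by simp)) (s :: (ρ ++ r)))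
            (Runs.cons (Runs.cons (Runs.of_value rfl) (Runs.call (runs_append hL ρ r
              (ho ρ (by simp))) (Runs.of_value rfl))) (Runs.of_value rfl)))
            (Runs.call ⟨_, rfl, ih⟩ (Runs.of_value rfl))))).mono ?_
        simp only [Code.size, Code.nth, Code.drop, Code.tuple, List.length_cons]
        ring_nf
        omega
  refine key.mono (mul_succ_le_pow (p := 4) hL ?_ hTL)
  have := Nat.one_le_pow 3 L (by omega)
  have : 100 * L ^ 3 ≤ L ^ 4 := hundred_mul_pow_le hL 3
  have := Nat.pow_le_pow_right (show 0 < L by omega) (show 2 ≤ 4 by omega)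
  omega

end SocialLearning

/-! ### Cost of the actions of one agent and of listing the possible observations -/

namespace SocialLearning

open Program

variable {V : Type*} {m k : ℕ} {M : Model V m k} {L : ℕ}

theorem pow_bounds (hL : 100 ≤ L) (p : ℕ) : 100 ≤ L ^ (p + 1) := by
  calc 100 ≤ L := hL
    _ ≤ L ^ (p + 1) := Nat.le_self_pow (by omega) L

/-- A bound for a list of tables. -/
def TablesSmall (L : ℕ) (TL : List (Table m)) : Prop :=
  TL.length + 1 ≤ L ∧ ∀ T ∈ TL, T.Small L

/-- A bound for the past actions of the neighbors. -/
def SeqsSmall (L : ℕ) (o : List (List (Fin m))) : Prop :=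
  ∀ ρ ∈ o, ρ.length + 1 ≤ L

theorem runs_weights (hL : 100 ≤ L) (hm : m + 1 ≤ L) (hk : k + 1 ≤ L) (t : ℕ) (j : V) (a : Fin k)
    {TL : List (Table m)} (hTL : TablesSmall L TL) {o : List (List (Fin m))} (ho : SeqsSmall L o)
    (r : List (Fin m)) :
    FnRuns M dynamicCavity fWeights (Val.tuple [Val.tuple [Val.ofSeq r, .vtx j, .num t,
      Val.ofFin a, Val.ofList Val.ofTable TL, Val.ofSeqs o], .nil,
      Val.ofList Val.ofFin (List.finRange m)])
      (Val.ofList (fun e : Fin m × ℝ => .cons (Val.ofFin e.1) (.num e.2))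
        ((List.finRange m).map fun s => (s, M.weight j a TL o r s))) (L ^ 8) := by
  have h := FnRuns.fold (M := M) (P := dynamicCavity) (f := fWeights) rfl
    (encα := Val.ofFin)
    (encβ := Val.ofList (fun e : Fin m × ℝ => .cons (Val.ofFin e.1) (.num e.2)))
    (g := fun s b => (s, M.weight j a TL o r s) :: b)
    (ctx := Val.tuple [Val.ofSeq r, .vtx j, .num t,
      Val.ofFin a, Val.ofList Val.ofTable TL, Val.ofSeqs o]) (b := []) (l := List.finRange m) _
    fun s _ b arg => Runs.cons (Runs.cons (Runs.of_value rfl) (Runs.mul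
      (Runs.call (runs_likelihood hL s r hTL.1 hTL.2 ho) (Runs.of_value rfl))
      (Runs.mul (Runs.call (runs_nth hL hm (fun s => .num (M.prior s).toReal) s)
        (Runs.cons Runs.prior (Runs.of_value rfl)))
        (runs_signalProb hL hm hk (Runs.of_value rfl) (Runs.of_value rfl) (Runs.of_value rfl)))))
        (Runs.of_value rfl)
  rw [← List.map_eq_foldr] at h
  refine h.mono (mul_succ_le_pow (p := 6) hL ?_ (by simpa using hm))
  have : L ^ 2 ≤ L ^ 6 := Nat.pow_le_pow_right (by omega) (by omega)
  have : 100 ≤ L ^ 6 := pow_bounds hL 5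
  simp only [Code.size, Code.nth, Code.drop, Code.tuple]
  omega

theorem runs_action (hL : 100 ≤ L) (hm : m + 1 ≤ L) (hk : k + 1 ≤ L) (t : ℕ) (j : V) (a : Fin k)
    {TL : List (Table m)} (hTL : TablesSmall L TL) {o : List (List (Fin m))} (ho : SeqsSmall L o)
    (r : List (Fin m)) :
    FnRuns M dynamicCavity fAction (Val.tuple [Val.ofSeq r, .vtx j, .num t,
      Val.ofFin a, Val.ofList Val.ofTable TL, Val.ofSeqs o])
      (Val.ofFin (M.tableAction t j a TL o r)) (L ^ 9) := by
  classical
  have hlen : ((List.finRange m).map fun s => (s, M.weight j a TL o r s)).length + 1 ≤ L := by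
    simpa using hm
  have h1 := runs_max (M := M) hL _ hlen
  have h2 := runs_best (M := M) hL
    ((((List.finRange m).map fun s => (s, M.weight j a TL o r s)).map Prod.snd).foldr max 0) _ hlen
  have h3 : (((List.finRange m).map fun s => (s, M.weight j a TL o r s)).filter fun e =>
      (((List.finRange m).map fun s => (s, M.weight j a TL o r s)).map Prod.snd).foldr max 0
        ≤ e.2).map Prod.fst =
      (List.finRange m).filter fun s => s ∈ maximizers (M.weight j a TL o r) := by
    rw [List.filter_map, List.map_map]
    simp only [Function.comp_def, List.map_id']
    refine List.filter_congr fun s _ => ?_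
    simp [maximizers, Function.comp_def]
  rw [h3] at h2
  refine FnRuns.mono ⟨_, rfl, Runs.bind (Runs.call (runs_weights hL hm hk t j a hTL ho r)
    (Runs.cons (Runs.of_value rfl) (Runs.cons (Runs.of_value rfl)
      (Runs.cons (runs_states hL hm _) (Runs.of_value rfl))))) (Runs.bind (Runs.call h2
        (Runs.cons (Runs.call h1 (Runs.of_value rfl)) (Runs.of_value rfl)))
          (Runs.tie (i := j) (t := t) (a := a) (o := o)
            (A := maximizers (M.weight j a TL o r)) (Runs.of_value rfl)))⟩ ?_
  have : L ^ 2 ≤ L ^ 8 := Nat.pow_le_pow_right (by omega) (by omega)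
  have : 100 ≤ L ^ 8 := pow_bounds hL 7
  have : 100 * L ^ 8 ≤ L ^ 9 := hundred_mul_pow_le hL 8
  simp only [Code.size, Code.nth, Code.drop, Code.tuple]
  omega

/-- The list of observations is traversed only at positive times. For `t = 0` its length may exceed
`L`, hence the form of `ho'`. -/
theorem runs_run (hL : 100 ≤ L) (hm : m + 1 ≤ L) (hk : k + 1 ≤ L) {t : ℕ} (ht : t + 1 ≤ L) (j : V)
    (a : Fin k) {TL : List (Table m)} (hTL : TablesSmall L TL) {o : List (List (Fin m))}
    (ho : SeqsSmall L o) (ho' : 0 < t → o.length + 1 ≤ L) :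
    FnRuns M dynamicCavity fRun (Val.tuple [.vtx j, .num t,
      Val.ofFin a, Val.ofList Val.ofTable TL, Val.ofSeqs o])
      (Val.ofSeq (M.tableActions t j a TL o)) (L ^ 11) := by
  have key : FnRuns M dynamicCavity fRun (Val.tuple [.vtx j, .num t,
      Val.ofFin a, Val.ofList Val.ofTable TL, Val.ofSeqs o])
      (Val.ofSeq (M.tableActions t j a TL o)) ((L ^ 9 + L ^ 2 + 100) * (t + 1)) := by
    clear ht
    refine ⟨_, rfl, ?_⟩
    induction t generalizing o with
    | zero =>
      refine Runs.mono (Runs.bind (v₁ := .nil) (Runs.ifZero (Runs.of_value rfl) (by simp)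
        (Runs.of_value rfl)) (Runs.cons (Runs.call (runs_action hL hm hk 0 j a hTL ho [])
          (Runs.of_value rfl)) (Runs.of_value rfl))) ?_
      simp only [Code.size, Code.nth, Code.drop]
      omega
    | succ t ih =>
      specialize ih (o := o.map List.tail) (by
        intro ρ hρ
        obtain ⟨ρ, hρ', rfl⟩ := List.mem_map.1 hρ
        have := ho ρ hρ'
        rw [List.length_tail]
        omega) (fun _ => by rw [List.length_map]; exact ho' (by omega))
      refine Runs.mono (Runs.bind (Runs.ifSucc (Runs.of_value rfl) (Runs.call ⟨_, rfl, ih⟩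
        (Runs.cons (Runs.of_value rfl) (Runs.cons (Runs.pred (Runs.of_value rfl))
          (Runs.cons (Runs.of_value rfl) (Runs.cons (Runs.of_value rfl)
            (Runs.cons (Runs.call (runs_mapTail hL o (ho' (by omega))) (Runs.of_value rfl))
              (Runs.of_value rfl)))))))) (Runs.cons (Runs.call (runs_action hL hm hk (t + 1) j a
                hTL ho _) (Runs.of_value rfl)) (Runs.of_value rfl))) ?_
      simp only [Code.size, Code.nth, Code.drop, Code.tuple]
      ring_nf
      omega
  refine key.mono (mul_succ_le_pow (p := 9) hL ?_ ht)
  have : L ^ 2 ≤ L ^ 9 := Nat.pow_le_pow_right (by omega) (by omega)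
  have : 100 ≤ L ^ 9 := pow_bounds hL 8
  omega

theorem length_sequences (n : ℕ) : (sequences m n).length = m ^ n := by
  induction n with
  | zero => rfl
  | succ n ih =>
    have h : sequences m (n + 1) = (sequences m n).flatMap fun l =>
        (List.finRange m).map fun a => a :: l := rfl
    rw [h, List.length_flatMap]
    simp [ih, pow_succ]

theorem runs_sequences (hL : 100 ≤ L) (hm : m + 1 ≤ L) {n : ℕ} (hn : n + 1 ≤ L)
    (hn' : ∀ n' < n, m ^ n' + 1 ≤ L) :
    FnRuns M dynamicCavity fSequences (.num n) (Val.ofSeqs (sequences m n)) (L ^ 6) := by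
  have key : FnRuns M dynamicCavity fSequences (.num n) (Val.ofSeqs (sequences m n))
      ((L ^ 4 + L ^ 2 + 100) * (n + 1)) := by
    clear hn
    refine ⟨_, rfl, ?_⟩
    induction n with
    | zero =>
      refine Runs.mono (Runs.ifZero (Runs.of_value rfl) (by simp) (Runs.of_value rfl)) ?_
      simp only [Code.size]
      omega
    | succ n ih =>
      specialize ih fun n' h => hn' n' (by omega)
      have h := hn' n (by omega)
      refine Runs.mono (Runs.ifSucc (Runs.of_value rfl) (Runs.call (runs_prod hL Val.ofFin
        (List.finRange m) (sequences m n) (by simpa using hm)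
          (by rw [length_sequences]; exact h)) (Runs.cons (runs_states hL hm _)
            (Runs.cons (Runs.of_value rfl) (Runs.cons (Runs.call ⟨_, rfl, ih⟩
              (Runs.pred (Runs.of_value rfl))) (Runs.of_value rfl)))))) ?_
      simp only [Code.size, Code.tuple]
      ring_nf
      omega
  refine key.mono (mul_succ_le_pow (p := 4) hL ?_ hn)
  have : L ^ 2 ≤ L ^ 4 := Nat.pow_le_pow_right (by omega) (by omega)
  have : 100 ≤ L ^ 4 := pow_bounds hL 3
  omega

open Classical in
theorem length_sections_le (i : V) (τ : List (Fin m)) (n d : ℕ) (l : List V) (hm : 0 < m)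
    (hl : l.length ≤ d) :
    (l.map fun l => if l = i then [τ] else sequences m n).sections.length ≤ m ^ (n * d) := by
  induction l generalizing d with
  | nil => exact Nat.one_le_pow _ _ hm
  | cons a l ih =>
    obtain ⟨d, rfl⟩ : ∃ d', d = d' + 1 := ⟨d - 1, by simp at hl; omega⟩
    rw [List.map_cons, List.sections, List.length_flatMap]
    simp only [List.length_map, List.map_const', List.sum_replicate, smul_eq_mul]
    rw [mul_add, pow_add, mul_one]
    refine Nat.mul_le_mul (ih d (by simpa using hl)) ?_
    split_ifs
    · exact Nat.one_le_pow _ _ hm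
    · exact (length_sequences n).le

/-- Each intermediate list consists of the views restricted to a suffix of the neighbors, so it too
has at most `m ^ (n * d)` entries. -/
theorem runs_views (hL : 100 ≤ L) (hm : 0 < m) {n d : ℕ} (hn : m ^ n + 1 ≤ L)
    (hnd : m ^ (n * d) + 1 ≤ L) (hd : d + 1 ≤ L) {j : V} (hj : (M.nbrs j).length ≤ d) (i : V)
    (τ : List (Fin m)) :
    FnRuns M dynamicCavity fViews (Val.tuple [Val.tuple [.vtx i, Val.ofSeq τ,
      Val.ofSeqs (sequences m n)], Val.cons .nil .nil, Val.ofList .vtx (M.nbrs j)])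
      (Val.ofList Val.ofSeqs (M.views j i τ n)) (L ^ 6) := by
  classical
  have h2 : ∀ l : List V, (l.map fun l => if l = i then [τ] else sequences m n).sections =
      l.foldr (fun l acc => acc.flatMap fun o =>
        (if l = i then [τ] else sequences m n).map fun ρ => ρ :: o) [[]] := by
    intro l
    induction l with
    | nil => rfl
    | cons a l ih => rw [List.foldr_cons, ← ih]; rfl
  have h := FnRuns.fold_suffix (M := M) (P := dynamicCavity) (f := fViews) rfl
    (encα := .vtx) (encβ := Val.ofList Val.ofSeqs)
    (g := fun l acc => acc.flatMap fun o =>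
        (if l = i then [τ] else sequences m n).map fun ρ => ρ :: o)
    (ctx := Val.tuple [.vtx i, Val.ofSeq τ, Val.ofSeqs (sequences m n)]) (b := [[]])
    (l := M.nbrs j) (L ^ 4 + 40)
    fun l l' hl' arg => by
      have hlen : (l'.foldr (fun l acc => acc.flatMap fun o =>
          (if l = i then [τ] else sequences m n).map fun ρ => ρ :: o) [[]]).length + 1 ≤ L := by
        rw [← h2]
        have := length_sections_le i τ n d l' hm (by have := hl'.length_le; simp at this; omega)
        omega
      refine Runs.mono (Runs.call (runs_prod hL Val.ofSeq
        (if l = i then [τ] else sequences m n) _ ?_ hlen) (Runs.cons (c₁ := 20) ?_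
          (Runs.of_value rfl))) (by simp only [Code.size, Code.tuple]; omega)
      · split_ifs
        · simp; omega
        · rw [length_sequences]; exact hn
      · split_ifs with hi
        · exact (Runs.ifEq_true (Runs.of_value rfl) (Runs.of_value rfl) hi
            (Runs.of_value rfl)).mono (by simp [Code.size, Code.nth, Code.drop])
        · exact (Runs.ifEq_false (Runs.of_value rfl) (Runs.of_value rfl) hi
            (Runs.of_value rfl)).mono (by simp [Code.size, Code.nth, Code.drop])
  rw [← h2] at h
  have : 100 ≤ L ^ 4 := pow_bounds hL 3
  exact h.mono (mul_succ_le_pow (p := 4) hL (by omega) (by omega))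

end SocialLearning

/-! ### Size and cost of the tables -/

namespace SocialLearning

open Program

variable {V : Type*} {m k : ℕ} {M : Model V m k} {L n d : ℕ}

/-- A bound for the sizes of all lists that occur in the computation of tables for sequences of at
most `n` actions. -/
structure SizeBound (m k d n L : ℕ) : Prop where
  pos : 0 < m
  large : 100 ≤ L
  states : m + 1 ≤ L
  signals : k + 1 ≤ L
  degree : d + 1 ≤ L
  time : 2 * n + 2 ≤ L
  sequences : m ^ n + 1 ≤ L
  views : m ^ (n * d) + 1 ≤ L
  table : n * (m * (m ^ n) ^ 2) + 1 ≤ L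

theorem SizeBound.mono {n' : ℕ} (h : SizeBound m k d n L) (hn : n' ≤ n) :
    SizeBound m k d n' L where
  pos := h.pos
  large := h.large
  states := h.states
  signals := h.signals
  degree := h.degree
  time := by have := h.time; omega
  sequences := (Nat.add_le_add_right (Nat.pow_le_pow_right h.pos hn) 1).trans h.sequences
  views := (Nat.add_le_add_right (Nat.pow_le_pow_right h.pos
    (Nat.mul_le_mul_right d hn)) 1).trans h.views
  table := (Nat.add_le_add_right (Nat.mul_le_mul hn (Nat.mul_le_mul_left _ (Nat.pow_le_pow_left
    (Nat.pow_le_pow_right h.pos hn) 2))) 1).trans h.table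

theorem length_entries (j i : V) (TL TL' : List (Table m)) :
    (M.entries n j i TL TL').length = m * (m ^ (n + 1)) ^ 2 := by
  simp [Model.entries, List.length_flatMap, length_sequences, pow_two]

/-- The table consists of `n` blocks, of which the newest is the largest. -/
theorem length_table_le (hm : 0 < m) (n : ℕ) (j i : V) :
    (M.table n j i).length ≤ n * (m * (m ^ n) ^ 2) := by
  induction n with
  | zero => simp [Model.table]
  | succ n ih =>
    rw [Model.table_succ, List.length_append, length_entries, Nat.succ_mul, add_comm]
    refine Nat.add_le_add_right (ih.trans ?_) _
    gcongr
    omega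

theorem length_key_of_mem_table {n : ℕ} {j i : V} {e : List (Fin m) × ℝ} (he : e ∈ M.table n j i) :
    e.1.length + 1 ≤ 2 * n + 2 := by
  induction n with
  | zero => simp [Model.table] at he
  | succ n ih =>
    rw [Model.table_succ, List.mem_append] at he
    rcases he with he | he
    · obtain ⟨s, σ, τ, h1, h2, rfl⟩ := Model.mem_entries.1 he
      simp [h1, h2]
      omega
    · have := ih he
      omega

theorem SizeBound.tablesSmall (h : SizeBound m k d n L) {j : V} (hj : (M.nbrs j).length ≤ d)
    (i : V) : TablesSmall L (M.tables n j i) := by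
  refine ⟨?_, fun T hT => ?_⟩
  · rw [Model.tables, List.length_map]
    have := h.degree
    omega
  · obtain ⟨l, -, rfl⟩ := List.mem_map.1 hT
    split_ifs
    · have := h.large
      exact ⟨by simp; omega, by simp⟩
    · exact ⟨(Nat.add_le_add_right (length_table_le h.pos n l j) 1).trans h.table,
        fun e he => (length_key_of_mem_table he).trans h.time⟩

theorem SizeBound.length_views_le (h : SizeBound m k d n L) {j : V} (hj : (M.nbrs j).length ≤ d)
    (i : V) (τ : List (Fin m)) : (M.views j i τ n).length + 1 ≤ L :=
  (Nat.add_le_add_right (length_sections_le i τ n d _ h.pos hj) 1).trans h.views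

theorem SizeBound.views_small (h : SizeBound m k d n L) {j : V} (hj : (M.nbrs j).length ≤ d)
    {i : V} {τ : List (Fin m)} (hτ : τ.length = n) {o : List (List (Fin m))}
    (ho : o ∈ M.views j i τ n) : o.length + 1 ≤ L ∧ SeqsSmall L o := by
  rw [Model.mem_views] at ho
  refine ⟨?_, fun ρ hρ => ?_⟩
  · rw [← ho.length_eq]
    have := h.degree
    omega
  · obtain ⟨q, hq, rfl⟩ := List.getElem_of_mem hρ
    have h1 := ho.get (i := q) (by rw [ho.length_eq]; exact hq) hq
    have h2 := h.time
    by_cases hi : (M.nbrs j).get ⟨q, by rw [ho.length_eq]; exact hq⟩ = i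
    · have := h1.1 hi
      simp only [List.get_eq_getElem] at this
      rw [this]
      omega
    · have := h1.2 hi
      simp only [List.get_eq_getElem] at this
      omega

theorem length_tableActions (t : ℕ) (j : V) (a : Fin k) (TL : List (Table m))
    (o : List (List (Fin m))) : (M.tableActions t j a TL o).length = t + 1 := by
  induction t generalizing o with
  | zero => rfl
  | succ t ih => rw [Model.tableActions, List.length_cons, ih]

-- The initial value `b` is arbitrary because the surrounding loop over the signals passes its
-- partial sum to this one. The loops that build table entries pass a partial table `T` in the same
-- way.
open Classical in
theorem runs_sumViews (h : SizeBound m k d n L) (j : V) (a : Fin k) {TL TL' : List (Table m)}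
    (hTL : TablesSmall L TL) (hTL' : TablesSmall L TL') (σ : List (Fin m)) (s : Fin m)
    {l : List (List (List (Fin m)))} (hl : l.length + 1 ≤ L)
    (hl' : ∀ o ∈ l, o.length + 1 ≤ L ∧ SeqsSmall L o) (b : ℝ) :
    FnRuns M dynamicCavity fSumViews (Val.tuple [Val.tuple [.vtx j, .num n, Val.ofFin a,
      Val.ofList Val.ofTable TL, Val.ofSeq σ, Val.ofFin s, Val.ofList Val.ofTable TL'], .num b,
      Val.ofList Val.ofSeqs l])
      (.num ((l.map fun o => if M.tableActions n j a TL o = σ then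
        (M.signal j s a).toReal * likelihood s σ.tail TL' o else 0).sum + b)) (L ^ 13) := by
  have hL := h.large
  have ht := h.time
  have e : (l.map fun o => if M.tableActions n j a TL o = σ then
        (M.signal j s a).toReal * likelihood s σ.tail TL' o else 0).sum + b =
      l.foldr (fun o b => if M.tableActions n j a TL o = σ then
        (M.signal j s a).toReal * likelihood s σ.tail TL' o + b else b) b := by
    clear hl hl'
    induction l with
    | nil => simp
    | cons o l ih =>
      rw [List.foldr_cons, ← ih, List.map_cons, List.sum_cons]
      split_ifs <;> ring
  have p1 : L ^ 2 ≤ L ^ 11 := Nat.pow_le_pow_right (by omega) (by omega)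
  have p2 : L ^ 6 ≤ L ^ 11 := Nat.pow_le_pow_right (by omega) (by omega)
  have p3 : 100 ≤ L ^ 11 := pow_bounds hL 10
  rw [e]
  refine (FnRuns.fold (M := M) (P := dynamicCavity) (f := fSumViews) rfl (encα := Val.ofSeqs)
    (encβ := .num) (L ^ 11 + L ^ 6 + 3 * L ^ 2 + 120) fun o ho b arg => ?_).mono
      (mul_succ_le_pow (p := 11) hL (by omega) hl)
  have h0 := runs_run (M := M) hL h.states h.signals (t := n) (by omega) j a hTL (hl' o ho).2
    fun _ => (hl' o ho).1
  have h1 := runs_eq (M := M) (M.tableActions n j a TL o) σ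
  have h2 : 40 * ((M.tableActions n j a TL o).length + 1) ≤ L ^ 2 := by
    rw [length_tableActions, pow_two]
    exact Nat.mul_le_mul (by omega) (by omega)
  split_ifs with hif
  · rw [if_pos hif] at h1
    refine (Runs.ifNil_nil (Runs.call h1 (Runs.cons (Runs.call h0 (Runs.of_value rfl))
      (Runs.of_value rfl))) (Runs.add (Runs.mul (runs_signalProb hL h.states h.signals
        (Runs.of_value rfl) (Runs.of_value rfl) (Runs.of_value rfl)) (Runs.call
          (runs_likelihood hL s σ.tail hTL'.1 hTL'.2 (hl' o ho).2) (Runs.cons (Runs.of_value rfl)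
            (Runs.cons (Runs.safeTail (Runs.of_value rfl)) (Runs.of_value rfl)))))
              (Runs.of_value rfl))).mono ?_
    simp only [Code.size, Code.nth, Code.drop, Code.tuple]
    omega
  · rw [if_neg hif] at h1
    refine (Runs.ifNil_cons (Runs.call h1 (Runs.cons (Runs.call h0 (Runs.of_value rfl))
      (Runs.of_value rfl))) (Runs.of_value rfl)).mono ?_
    simp only [Code.size, Code.nth, Code.drop, Code.tuple]
    omega

open Classical in
theorem runs_sumSignals (h : SizeBound m k d n L) (j : V) {TL TL' : List (Table m)}
    (hTL : TablesSmall L TL) (hTL' : TablesSmall L TL') (σ : List (Fin m)) (s : Fin m)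
    {l : List (List (List (Fin m)))} (hl : l.length + 1 ≤ L)
    (hl' : ∀ o ∈ l, o.length + 1 ≤ L ∧ SeqsSmall L o) :
    FnRuns M dynamicCavity fSumSignals (Val.tuple [Val.tuple [.vtx j, .num n,
      Val.ofList Val.ofTable TL, Val.ofSeq σ, Val.ofFin s, Val.ofList Val.ofTable TL',
      Val.ofList Val.ofSeqs l], .num (0 : ℕ), Val.ofList Val.ofFin (List.finRange k)])
      (.num ((List.finRange k).map fun a => (l.map fun o => if M.tableActions n j a TL o = σ then
        (M.signal j s a).toReal * likelihood s σ.tail TL' o else 0).sum).sum) (L ^ 15) := by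
  have hL := h.large
  have p3 : 100 ≤ L ^ 13 := pow_bounds hL 12
  have h1 := FnRuns.fold (M := M) (P := dynamicCavity) (f := fSumSignals) rfl
    (encα := Val.ofFin) (encβ := .num)
    (g := fun a b => (l.map fun o => if M.tableActions n j a TL o = σ then
        (M.signal j s a).toReal * likelihood s σ.tail TL' o else 0).sum + b)
    (ctx := Val.tuple [.vtx j, .num n,
      Val.ofList Val.ofTable TL, Val.ofSeq σ, Val.ofFin s, Val.ofList Val.ofTable TL',
      Val.ofList Val.ofSeqs l]) (b := ((0 : ℕ) : ℝ)) (l := List.finRange k) _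
    fun a _ b arg => Runs.call (runs_sumViews h j a hTL hTL' σ s hl hl' b) (Runs.of_value rfl)
  have e : ∀ (f : Fin k → ℝ) (l : List (Fin k)),
      l.foldr (fun a b => f a + b) ((0 : ℕ) : ℝ) = (l.map f).sum := by
    intro f l
    induction l with
    | nil => simp
    | cons a l ih => rw [List.foldr_cons, ih, List.map_cons, List.sum_cons]
  rw [e] at h1
  refine h1.mono (mul_succ_le_pow (p := 13) hL ?_ (by simpa using h.signals))
  simp only [Code.size, Code.nth, Code.drop, Code.tuple]
  omega

/-- The context of the computation of the entries of a table. -/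
abbrev entriesContext (n : ℕ) (j i : V) (TL TL' : List (Table m)) :
    List (Val V) :=
  [.vtx j, .vtx i, .num n, Val.ofList Val.ofTable TL, Val.ofList Val.ofTable TL',
    Val.ofSeqs (sequences m n), Val.ofSeqs (sequences m (n + 1))]

theorem runs_entries₃ (h : SizeBound m k d n L) (hn : m ^ (n + 1) + 1 ≤ L) {j : V}
    (hj : (M.nbrs j).length ≤ d) (i : V) {TL TL' : List (Table m)} (hTL : TablesSmall L TL)
    (hTL' : TablesSmall L TL') (s : Fin m) {σ : List (Fin m)} (hσ : σ.length = n + 1)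
    (T : Table m) :
    FnRuns M dynamicCavity fEntries₃ (Val.tuple [Val.tuple (Val.ofSeq σ :: Val.ofFin s ::
      entriesContext n j i TL TL'), Val.ofTable T, Val.ofSeqs (sequences m (n + 1))])
      (Val.ofTable (((sequences m (n + 1)).map fun τ =>
        (s :: (σ ++ τ), M.entry n j i TL TL' s σ τ)) ++ T)) (L ^ 17) := by
  have hL := h.large
  have ht := h.time
  have p1 : L ^ 2 ≤ L ^ 15 := Nat.pow_le_pow_right (by omega) (by omega)
  have p2 : L ^ 6 ≤ L ^ 15 := Nat.pow_le_pow_right (by omega) (by omega)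
  have p3 : 100 ≤ L ^ 15 := pow_bounds hL 14
  have e : ((sequences m (n + 1)).map fun τ =>
        (s :: (σ ++ τ), M.entry n j i TL TL' s σ τ)) ++ T =
      (sequences m (n + 1)).foldr (fun τ b =>
        (s :: (σ ++ τ), M.entry n j i TL TL' s σ τ) :: b) T := by
    generalize sequences m (n + 1) = l
    induction l with
    | nil => rfl
    | cons a l ih => rw [List.foldr_cons, ← ih]; rfl
  rw [e]
  refine (FnRuns.fold (M := M) (P := dynamicCavity) (f := fEntries₃) rfl (encα := Val.ofSeq)
    (encβ := Val.ofTable) (L ^ 15 + L ^ 6 + 2 * L ^ 2 + 150) fun τ hτ b arg => ?_).mono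
      (mul_succ_le_pow (p := 15) hL (by omega) (by rw [length_sequences]; exact hn))
  rw [mem_sequences] at hτ
  have hτ' : τ.tail.length = n := by simp [hτ]
  have h1 := runs_sumSignals (M := M) h j hTL hTL' σ s (h.length_views_le hj i τ.tail) fun o ho =>
    h.views_small hj hτ' ho
  have h3 := runs_views hL h.pos h.sequences h.views h.degree hj i τ.tail
  refine Runs.mono (Runs.cons (Runs.cons (Runs.cons (Runs.of_value rfl) (Runs.call
    (runs_append hL σ τ (by omega)) (Runs.of_value rfl))) (Runs.call h1 (Runs.cons
      (Runs.cons (Runs.of_value rfl) (Runs.cons (Runs.of_value rfl) (Runs.cons (Runs.of_value rfl)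
        (Runs.cons (Runs.of_value rfl) (Runs.cons (Runs.of_value rfl) (Runs.cons (Runs.of_value rfl)
          (Runs.cons (Runs.call h3 (Runs.cons (Runs.cons (Runs.of_value rfl) (Runs.cons
            (Runs.safeTail (Runs.of_value rfl)) (Runs.of_value rfl))) (Runs.cons (Runs.of_value rfl)
              (Runs.cons (Runs.nbrs (Runs.of_value rfl)) (Runs.of_value rfl)))))
                (Runs.of_value rfl))))))))
      (Runs.cons (Runs.of_value rfl) (Runs.cons (runs_signals hL h.pos h.signals (Runs.of_value rfl))
          (Runs.of_value rfl)))))) (Runs.of_value rfl)) ?_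
  simp only [Code.size, Code.nth, Code.drop, Code.tuple]
  omega

theorem runs_entries₂ (h : SizeBound m k d n L) (hn : m ^ (n + 1) + 1 ≤ L) {j : V}
    (hj : (M.nbrs j).length ≤ d) (i : V) {TL TL' : List (Table m)} (hTL : TablesSmall L TL)
    (hTL' : TablesSmall L TL') (s : Fin m) (T : Table m) :
    FnRuns M dynamicCavity fEntries₂ (Val.tuple [Val.tuple (Val.ofFin s ::
      entriesContext n j i TL TL'), Val.ofTable T, Val.ofSeqs (sequences m (n + 1))])
      (Val.ofTable (((sequences m (n + 1)).flatMap fun σ => (sequences m (n + 1)).map fun τ =>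
        (s :: (σ ++ τ), M.entry n j i TL TL' s σ τ)) ++ T)) (L ^ 19) := by
  have hL := h.large
  have p3 : 100 ≤ L ^ 17 := pow_bounds hL 16
  have e : ∀ l : List (List (Fin m)), (l.flatMap fun σ => (sequences m (n + 1)).map fun τ =>
        (s :: (σ ++ τ), M.entry n j i TL TL' s σ τ)) ++ T =
      l.foldr (fun σ b => ((sequences m (n + 1)).map fun τ =>
        (s :: (σ ++ τ), M.entry n j i TL TL' s σ τ)) ++ b) T := by
    intro l
    induction l with
    | nil => rfl
    | cons a l ih => rw [List.foldr_cons, ← ih, List.flatMap_cons, List.append_assoc]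
  rw [e]
  refine (FnRuns.fold (M := M) (P := dynamicCavity) (f := fEntries₂) rfl (encα := Val.ofSeq)
    (encβ := Val.ofTable) (L ^ 17 + 60) fun σ hσ b arg => ?_).mono
      (mul_succ_le_pow (p := 17) hL (by omega) (by rw [length_sequences]; exact hn))
  refine Runs.mono (Runs.call (runs_entries₃ h hn hj i hTL hTL' s (mem_sequences.1 hσ) b)
    (Runs.of_value rfl)) ?_
  simp only [Code.size, Code.nth, Code.drop, Code.tuple]
  omega

theorem runs_entries₁ (h : SizeBound m k d n L) (hn : m ^ (n + 1) + 1 ≤ L) {j : V}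
    (hj : (M.nbrs j).length ≤ d) (i : V) {TL TL' : List (Table m)} (hTL : TablesSmall L TL)
    (hTL' : TablesSmall L TL') (T : Table m) :
    FnRuns M dynamicCavity fEntries₁ (Val.tuple [Val.tuple (entriesContext n j i TL TL'),
      Val.ofTable T, Val.ofList Val.ofFin (List.finRange m)])
      (Val.ofTable (M.entries n j i TL TL' ++ T)) (L ^ 21) := by
  have hL := h.large
  have p3 : 100 ≤ L ^ 19 := pow_bounds hL 18
  have e : ∀ l : List (Fin m), (l.flatMap fun s => (sequences m (n + 1)).flatMap fun σ =>
        (sequences m (n + 1)).map fun τ => (s :: (σ ++ τ), M.entry n j i TL TL' s σ τ)) ++ T =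
      l.foldr (fun s b => ((sequences m (n + 1)).flatMap fun σ =>
        (sequences m (n + 1)).map fun τ => (s :: (σ ++ τ), M.entry n j i TL TL' s σ τ)) ++ b) T := by
    intro l
    induction l with
    | nil => rfl
    | cons a l ih => rw [List.foldr_cons, ← ih, List.flatMap_cons, List.append_assoc]
  rw [Model.entries, e]
  refine (FnRuns.fold (M := M) (P := dynamicCavity) (f := fEntries₁) rfl (encα := Val.ofFin)
    (encβ := Val.ofTable) (L ^ 19 + 60) fun s _ b arg => ?_).mono
      (mul_succ_le_pow (p := 19) hL (by omega) (by simpa using h.states))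
  refine Runs.mono (Runs.call (runs_entries₂ h hn hj i hTL hTL' s b) (Runs.of_value rfl)) ?_
  simp only [Code.size, Code.nth, Code.drop, Code.tuple]
  omega

/-- Stated relative to a bound `B` for one table, since the two functions call each other and this
bound is the induction hypothesis of `runs_table`. -/
theorem runs_tables_of_table {B : ℕ} (hd : ∀ v, (M.nbrs v).length ≤ d)
    (h : ∀ j i, FnRuns M dynamicCavity fTable (Val.tuple [.vtx j, .vtx i, .num n])
      (Val.ofTable (M.table n j i)) B) (j i : V) :
    FnRuns M dynamicCavity fTables (Val.tuple [.vtx j, .vtx i, .num n])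
      (Val.ofList Val.ofTable (M.tables n j i)) ((B + 90) * (d + 1)) := by
  classical
  have h1 := FnRuns.fold (M := M) (P := dynamicCavity) (f := fTablesFold) rfl
    (encα := .vtx) (encβ := Val.ofList Val.ofTable)
    (g := fun l b => (if l = i then [] else M.table n l j) :: b)
    (ctx := Val.tuple [.vtx j, .vtx i, .num n]) (b := []) (l := M.nbrs j) (B + 30)
    fun l _ b arg => by
      split_ifs with hi
      · refine (Runs.cons (Runs.ifEq_true (Runs.of_value rfl) (Runs.of_value rfl) hi
          (Runs.of_value rfl)) (Runs.of_value rfl)).mono ?_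
        simp only [Code.size, Code.nth, Code.drop]
        omega
      · refine (Runs.cons (Runs.ifEq_false (Runs.of_value rfl) (Runs.of_value rfl) hi
          (Runs.call (h l j) (Runs.of_value rfl))) (Runs.of_value rfl)).mono ?_
        simp only [Code.size, Code.nth, Code.drop, Code.tuple]
        omega
  rw [← List.map_eq_foldr] at h1
  refine FnRuns.mono ⟨_, rfl, Runs.call h1 (Runs.cons (Runs.of_value rfl) (Runs.cons
    (Runs.of_value rfl) (Runs.cons (Runs.nbrs (Runs.of_value rfl)) (Runs.of_value rfl))))⟩ ?_
  have h2 : (B + 30 + 40) * ((M.nbrs j).length + 1) ≤ (B + 70) * (d + 1) :=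
    Nat.mul_le_mul_left _ (by have := hd j; omega)
  simp only [Code.size, Code.nth, Code.drop, Code.tuple]
  nlinarith

/-- If `Y` bounds the cost one level below, the two families of neighbor tables cost about `2 * (d +
1) * Y` and the older table of `j` another `Y`. The factor `2 * d + 4` leaves one spare `Y`, at
least `L ^ 23`, for the entries and the overhead. -/
theorem runs_table (hd : ∀ v, (M.nbrs v).length ≤ d) (h : SizeBound m k d n L) (j i : V) :
    FnRuns M dynamicCavity fTable (Val.tuple [.vtx j, .vtx i, .num n])
      (Val.ofTable (M.table n j i)) (L ^ 23 * (2 * d + 4) ^ n) := by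
  have hL := h.large
  induction n generalizing j i with
  | zero =>
    refine FnRuns.mono ⟨_, rfl, Runs.ifZero (Runs.of_value rfl) (by simp) (Runs.of_value rfl)⟩ ?_
    have p3 : 100 ≤ L ^ 23 := pow_bounds hL 22
    simp only [Code.size, Code.nth, Code.drop, pow_zero]
    omega
  | succ n ih =>
    have h' : SizeBound m k d n L := h.mono (by omega)
    specialize ih h'
    have h1 := runs_tables_of_table hd ih
    have h2 := runs_entries₁ h' h.sequences (hd j) i (h'.tablesSmall (hd j) j)
      (h'.tablesSmall (hd j) i) (M.table n j i)
    have ht := h.time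
    have h3 := runs_sequences (M := M) hL h.states (n := n) (by omega)
      fun n' hn' => (h.mono (n' := n') (by omega)).sequences
    have h4 := runs_sequences (M := M) hL h.states (n := n + 1) (by omega)
      fun n' hn' => (h.mono (n' := n') (by omega)).sequences
    refine FnRuns.mono ⟨_, rfl, Runs.ifSucc (Runs.of_value rfl) (Runs.bind (Runs.pred
      (Runs.of_value rfl)) (Runs.call h2 (Runs.cons (Runs.cons (Runs.of_value rfl) (Runs.cons
        (Runs.of_value rfl) (Runs.cons (Runs.of_value rfl) (Runs.cons (Runs.call (h1 j j)
          (Runs.of_value rfl)) (Runs.cons (Runs.call (h1 j i) (Runs.of_value rfl)) (Runs.cons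
            (Runs.call h3 (Runs.of_value rfl)) (Runs.cons (Runs.call h4 (Runs.of_value rfl))
              (Runs.of_value rfl)))))))) (Runs.cons (Runs.call (ih j i) (Runs.of_value rfl))
                (Runs.cons (runs_states hL h.states _) (Runs.of_value rfl))))))⟩ ?_
    have q1 : L ^ 2 ≤ L ^ 21 := Nat.pow_le_pow_right (by omega) (by omega)
    have q2 : L ^ 6 ≤ L ^ 21 := Nat.pow_le_pow_right (by omega) (by omega)
    have q3 : 100 ≤ L ^ 21 := pow_bounds hL 20
    have q4 : 100 * L ^ 21 ≤ L ^ 22 := hundred_mul_pow_le hL 21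
    have q5 : 100 * L ^ 22 ≤ L ^ 23 := hundred_mul_pow_le hL 22
    have q6 : d + 1 ≤ L ^ 21 := h.degree.trans (Nat.le_self_pow (by omega) L)
    have q7 : 1 ≤ (2 * d + 4) ^ n := Nat.one_le_pow _ _ (by omega)
    have q8 : L ^ 23 ≤ L ^ 23 * (2 * d + 4) ^ n := Nat.le_mul_of_pos_right _ q7
    simp only [Code.size, Code.nth, Code.drop, Code.tuple]
    rw [pow_succ (2 * d + 4), ← mul_assoc]
    generalize L ^ 23 * (2 * d + 4) ^ n = Y at *
    have e1 : (Y + 90) * (d + 1) = Y * d + Y + 90 * (d + 1) := by ring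
    have e2 : Y * (2 * d + 4) = 2 * (Y * d) + 4 * Y := by ring
    rw [e1, e2]
    omega

end SocialLearning

/-! ### Choice of the size bound and the final exponent -/

namespace SocialLearning

open Program

variable {V : Type*} {m k : ℕ} {M : Model V m k} {L n d : ℕ}

theorem pos_of_prior (p : PMF (Fin m)) : 0 < m := by
  obtain ⟨s, _⟩ := p.support_nonempty
  exact s.pos

/-- Linear quantities are bounded by `x ≤ b ^ x`. The required exponents are at most `t * d + 1` for
views, `3 * t + 2` for tables, and `d + 1` or `t + 2` for the rest; all lie below `4 * (t + 1) * d`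
as `d ≥ 1`. -/
theorem sizeBound (hm : 0 < m) (hd : 1 ≤ d) (t : ℕ) :
    SizeBound m k d t ((m + k + 100) ^ (4 * (t + 1) * d)) := by
  have hmb : m ≤ m + k + 100 := by omega
  set b := m + k + 100 with hb
  have hexp : 4 * t + 4 ≤ 4 * (t + 1) * d := by nlinarith
  have hle : ∀ {p x : ℕ}, x ≤ b ^ p → p ≤ 4 * (t + 1) * d → x ≤ b ^ (4 * (t + 1) * d) :=
    fun hx hp => hx.trans (Nat.pow_le_pow_right (by omega) hp)
  have hsucc : ∀ {p x : ℕ}, x ≤ b ^ p → x + 1 ≤ b ^ (p + 1) := fun {p x} hx => by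
    have := Nat.one_le_pow p b (by omega)
    rw [pow_succ]
    nlinarith
  have hlt : ∀ x : ℕ, x ≤ b ^ x := fun x => (Nat.lt_pow_self (by omega)).le
  have hmt : ∀ p : ℕ, m ^ p ≤ b ^ p := fun p => Nat.pow_le_pow_left hmb p
  have hd' : d ≤ 4 * (t + 1) * d := Nat.le_mul_of_pos_left _ (by omega)
  refine ⟨hm, ?_, ?_, ?_, ?_, ?_, ?_, ?_, ?_⟩
  · exact hle (p := 1) (by rw [pow_one]; omega) (by omega)
  · exact hle (p := 1) (by rw [pow_one]; omega) (by omega)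
  · exact hle (p := 1) (by rw [pow_one]; omega) (by omega)
  · exact hle (hsucc (hlt d)) (by nlinarith)
  · refine hle (p := t + 2) ?_ (by omega)
    have := hsucc (hlt t)
    rw [pow_succ]
    nlinarith
  · exact hle (hsucc (hmt t)) (by omega)
  · exact hle (hsucc (hmt (t * d))) (by nlinarith)
  · refine hle (hsucc (p := t + (1 + t * 2)) ?_) (by omega)
    rw [pow_add, pow_add, pow_one, pow_mul]
    exact Nat.mul_le_mul (hlt t) (Nat.mul_le_mul hmb (Nat.pow_le_pow_left (hmt t) 2))

theorem seqsSmall_traj {t : ℕ} (ht : t + 1 ≤ L) (i : V) (x : V → Fin k) :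
    SeqsSmall L ((M.nbrs i).map fun j => M.traj t j x) := by
  intro ρ hρ
  obtain ⟨l, -, rfl⟩ := List.mem_map.1 hρ
  rw [M.length_traj]
  exact ht

/-- At time `0` the bound must not depend on the degree, so the program skips the tables and never
traverses a list of neighbors; `L = m + k + 100` is enough. -/
theorem runs_main_zero (hM : M.graph.IsTree) (i : V) (x : V → Fin k) :
    FnRuns M dynamicCavity 0 (input M i x 0) (Val.ofSeq (M.traj 1 i x))
      ((m + k + 100) ^ 12) := by
  have hL : 100 ≤ m + k + 100 := by omega
  rw [← M.tableActions_zero_nil hM i x]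
  have h1 := runs_run (M := M) (L := m + k + 100) hL (by omega) (by omega) (t := 0) (by omega) i
    (x i) (TL := []) ⟨by simp, by simp⟩ (o := (M.nbrs i).map fun j => M.traj 0 j x)
    (seqsSmall_traj (by omega) i x) (by simp)
  refine FnRuns.mono ⟨_, rfl, Runs.call h1 (Runs.cons (Runs.of_value rfl) (Runs.cons
    (Runs.of_value rfl) (Runs.cons (Runs.of_value rfl) (Runs.cons (Runs.ifZero (Runs.of_value rfl)
      (by simp) (Runs.of_value rfl)) (Runs.of_value rfl)))))⟩ ?_
  have h2 : 100 * (m + k + 100) ^ 11 ≤ (m + k + 100) ^ 12 := hundred_mul_pow_le hL 11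
  have h3 : 100 ≤ (m + k + 100) ^ 11 := pow_bounds hL 10
  simp only [Code.size, Code.nth, Code.drop, Code.tuple]
  omega

theorem runs_main_succ (hM : M.graph.IsTree) (hd : ∀ v, (M.nbrs v).length ≤ d) {t : ℕ}
    (h : SizeBound m k d (t + 1) L) (i : V) (x : V → Fin k) :
    FnRuns M dynamicCavity 0 (input M i x (t + 1)) (Val.ofSeq (M.traj (t + 2) i x))
      (L ^ 25 * (2 * d + 4) ^ (t + 1)) := by
  have hL := h.large
  have ht := h.time
  rw [← M.tableActions_eq_traj hM (t + 1) i x]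
  have h1 := runs_run (M := M) hL h.states h.signals (t := t + 1) (by omega) i (x i)
    (h.tablesSmall (hd i) i) (o := (M.nbrs i).map fun j => M.traj (t + 1) j x)
    (seqsSmall_traj (by omega) i x)
    (fun _ => by rw [List.length_map]; exact (Nat.add_le_add_right (hd i) 1).trans h.degree)
  have h2 := runs_tables_of_table hd (runs_table hd h) i i
  refine FnRuns.mono ⟨_, rfl, Runs.call h1 (Runs.cons (Runs.of_value rfl) (Runs.cons
    (Runs.of_value rfl) (Runs.cons (Runs.of_value rfl) (Runs.cons (Runs.ifSucc (Runs.of_value rfl)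
      (Runs.call h2 (Runs.of_value rfl))) (Runs.of_value rfl)))))⟩ ?_
  have q1 : L ^ 11 ≤ L ^ 23 := Nat.pow_le_pow_right (by omega) (by omega)
  have q3 : 100 ≤ L ^ 23 := pow_bounds hL 22
  have q7 : 1 ≤ (2 * d + 4) ^ (t + 1) := Nat.one_le_pow _ _ (by omega)
  have q8 : L ^ 23 ≤ L ^ 23 * (2 * d + 4) ^ (t + 1) := Nat.le_mul_of_pos_right _ q7
  have e : L ^ 25 * (2 * d + 4) ^ (t + 1) = L ^ 23 * (2 * d + 4) ^ (t + 1) * L * L := by ring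
  have hd' := h.degree
  simp only [Code.size, Code.nth, Code.drop, Code.tuple]
  rw [e]
  generalize L ^ 23 * (2 * d + 4) ^ (t + 1) = Y at *
  have e1 : (Y + 90) * (d + 1) ≤ (2 * Y) * L := Nat.mul_le_mul (by omega) hd'
  have e2 : 100 * (Y * L) ≤ Y * L * L := by rw [mul_comm]; exact Nat.mul_le_mul_left _ hL
  have e3 : Y ≤ Y * L := Nat.le_mul_of_pos_right _ (by omega)
  rw [mul_assoc] at e1
  omega

/-- Uses `b ≤ 2 ^ b`, `2 * d + 4 ≤ 8 ^ d` and `t + 2 ≤ 2 * (t + 1)`: the size bound gives `200 * b`,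
the branching gives `3`, and the remaining `2` in the coefficient absorbs the summand `2`. -/
theorem cost_le (hd : 1 ≤ d) (t b : ℕ) :
    (b ^ (4 * (t + 1 + 1) * d)) ^ 25 * (2 * d + 4) ^ (t + 1) + 2 ≤
      2 ^ ((200 * b + 5) * ((t + 1) * d)) := by
  have h1 : b ≤ 2 ^ b := Nat.lt_two_pow_self.le
  have h2 : 2 * d + 4 ≤ 2 ^ (3 * d) := by
    rw [pow_mul]
    clear h1
    induction d, hd using Nat.le_induction with
    | base => norm_num
    | succ d hd ih => rw [pow_succ]; omega
  have hs : 1 ≤ (t + 1) * d := Nat.mul_pos (by omega) hd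
  calc (b ^ (4 * (t + 1 + 1) * d)) ^ 25 * (2 * d + 4) ^ (t + 1) + 2
      ≤ ((2 ^ b) ^ (4 * (t + 1 + 1) * d)) ^ 25 * (2 ^ (3 * d)) ^ (t + 1) + 2 := by gcongr
    _ = 2 ^ (100 * b * ((t + 1 + 1) * d) + 3 * ((t + 1) * d)) + 2 := by
      rw [← pow_mul, ← pow_mul, ← pow_mul, ← pow_add]
      ring_nf
    _ ≤ 2 ^ (200 * b * ((t + 1) * d) + 3 * ((t + 1) * d)) + 2 := by
      gcongr 2 ^ (?_ + _) + 2
      · norm_num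
      · rw [show 200 * b * ((t + 1) * d) = 100 * b * (2 * ((t + 1) * d)) by ring]
        refine Nat.mul_le_mul_left _ ?_
        rw [← mul_assoc]
        exact Nat.mul_le_mul_right _ (by omega)
    _ ≤ 2 ^ ((200 * b + 5) * ((t + 1) * d)) := by
      have e : (200 * b + 5) * ((t + 1) * d) =
        (200 * b * ((t + 1) * d) + 3 * ((t + 1) * d)) + 2 * ((t + 1) * d) := by ring
      rw [e]
      generalize 200 * b * ((t + 1) * d) + 3 * ((t + 1) * d) = z
      rw [pow_add]
      have h3 : 2 ^ 2 ≤ 2 ^ (2 * ((t + 1) * d)) := Nat.pow_le_pow_right (by omega) (by omega)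
      have h4 : 1 ≤ 2 ^ z := Nat.one_le_two_pow
      nlinarith

end SocialLearning

open SocialLearning in
theorem theorem3 :
    ∃ P : Program, ∀ m k : ℕ, ∃ C : ℕ,
      ∀ (V : Type*) (M : Model V m k), M.graph.IsTree →
      ∀ d : ℕ, 1 ≤ d → (∀ v, (M.nbrs v).length ≤ d) →
      ∀ (i : V) (x : V → Fin k) (t : ℕ),
        ∃ c ≤ 2 ^ (C * max 1 (t * d)),
          P.Computes M (input M i x t) (Val.ofList Val.ofFin (M.traj (t + 1) i x)) c := by
  refine ⟨Program.dynamicCavity, fun m k => ⟨200 * (m + k + 100) + 5, ?_⟩⟩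
  intro V M hM d hd hdeg i x t
  -- The two extra operations are the outer call and the evaluation of its argument.
  have key : ∀ {w c c'}, FnRuns M Program.dynamicCavity 0 (input M i x t) w c → c + 2 ≤ c' →
      ∃ a ≤ c', Program.dynamicCavity.Computes M (input M i x t) w a := fun h hc => by
    obtain ⟨a, ha, h⟩ := Runs.call h (Runs.of_value (env := [input M i x t]) (e := .var 0) rfl)
    exact ⟨a, by simp only [Code.size] at ha; omega, h⟩
  cases t with
  | zero =>
    refine key (runs_main_zero hM i x) ?_
    -- The estimate is used with degree bound `1`, where its exponent is the constant itself; its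
    -- left side is far larger than the twelfth power needed here.
    have h1 := cost_le le_rfl 0 (m + k + 100)
    simp only [zero_mul, Nat.max_eq_left (Nat.zero_le 1)]
    refine le_trans (Nat.add_le_add_right ?_ 2) h1
    rw [← pow_mul]
    exact (Nat.pow_le_pow_right (by omega) (by omega)).trans
      (Nat.le_mul_of_pos_right _ (by positivity))
  | succ t =>
    refine key (runs_main_succ hM hdeg (sizeBound (pos_of_prior M.prior) hd (t + 1)) i x) ?_
    rw [Nat.max_eq_right (Nat.mul_pos (by omega) hd)]
    exact cost_le hd t (m + k + 100)
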